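/- Let $\mathbb K$ be an algebraically closed field of characteristic zero and let $\omega\in\mathbb R^N$ have rationally independent coordinates. Let $S_\omega$ be the field of $\omega$-positive Puiseux series, that is, of formal series $\varphi=\sum_{\alpha}c_\alpha x^\alpha$ with $c_\alpha\in\mathbb K$ whose set of exponents $\mathcal E(\varphi)=\{\alpha\in\mathbb Q^N\mid c_\alpha\ne0\}$ is contained in $\frac1k\mathbb Z^N$ for some integer $k\ge1$ and satisfies $\gamma+\mathcal E(\varphi)\subset\sigma$ for some $\gamma\in\mathbb Q^N$ and some convex rational polyhedral cone $\sigma\subset\mathbb R^N$ with $\omega\cdot v\ge0$ for all $v\in\sigma$. For $\varphi\neq 0$ in $S_\omega$ set $\operatorname{ord}_\omega\varphi=\min_{\alpha\in\mathcal E(\varphi)}\omega\cdot\alpha$, and let the first term of $\varphi$ be $\operatorname{in}_\omega\varphi=c_\alpha x^\alpha$, where $\alpha\in\mathcal E(\varphi)$ is the unique exponent with $\omega\cdot\alpha=\operatorname{ord}_\omega\varphi$; set $\operatorname{ord}_\omega 0=\infty$ and $\operatorname{in}_\omega 0=0$. For $M$-tuples of series, $\operatorname{ord}_\omega$ and $\operatorname{in}_\omega$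 are taken componentwise. Let $\eta\in(\mathbb R\cup\{\infty\})^M$, with the conventions $\infty\cdot0=0$ and $\infty\cdot a=\infty$ for $a>0$. For $f=\sum_\beta\phi_\beta y^\beta\in S_\omega[y]=S_\omega[y_1,\dots,y_M]$ let $\operatorname{ord}_{\omega,\eta}f=\min_{\phi_\beta\ne0}(\operatorname{ord}_\omega\phi_\beta+\eta\cdot\beta)$ (which is $\infty$ for $f=0$), and let the $\eta$-initial part of $f$ be $$\operatorname{in}_{\omega,\eta}f=\sum_{\operatorname{ord}_\omega\phi_\beta+\eta\cdot\beta=\operatorname{ord}_{\omega,\eta}f}(\operatorname{in}_\omega\phi_\beta)\,y^\beta$$ if $\operatorname{ord}_{\omega,\eta}f<\infty$, and $0$ otherwise. The $\eta$-initial ideal of an ideal $\mathfrak I\subset S_\omega[y]$ is the ideal of $S_\omega[y]$ generated by $\{\operatorname{in}_{\omega,\eta}f\mid f\in\mathfrak I\}\cup\{y_i\mid\eta_i=\infty\}$. Let $T_\eta\subset S_\omega^M$ be the set of all $\phi$ with $\phi_i\neq0$ whenever $\eta_i\ne\infty$ and $\phi_i=0$ whenever $\eta_i=\infty$. **Proposition.**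 Let $\mathfrak I\subset S_\omega[y]$ be an ideal with finitely many zeroes in $S_\omega^M$ and let $\eta\in(\mathbb R\cup\{\infty\})^M$. An element $\phi\in T_\eta$ is a zero of the $\eta$-initial ideal of $\mathfrak I$ if and only if $\operatorname{ord}_\omega\phi=\eta$ and there exists a zero $\varphi\in S_\omega^M$ of $\mathfrak I$ with $\operatorname{in}_\omega\varphi=\phi$. -/

import Mathlib

namespace OmegaPuiseux

noncomputable section

/-! ### Exponents -/

/-- The scalar product `ω · α` of a real vector `ω` and a rational exponent `α`. -/
def dot {N : ℕ} (ω : Fin N → ℝ) (α : Fin N → ℚ) : ℝ := ∑ i, ω i * (α i : ℝ)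

/-- The rational vector `α`, seen as a point of `ℝ^N`. -/
def toReal {N : ℕ} (α : Fin N → ℚ) : Fin N → ℝ := fun i => (α i : ℝ)

/-- The group of exponents `ℚ^N`, to be ordered by the vector `ω`. -/
def Expo {N : ℕ} (_ω : Fin N → ℝ) : Type := Fin N → ℚ

instance {N : ℕ} (ω : Fin N → ℝ) : AddCommGroup (Expo ω) :=
  inferInstanceAs (AddCommGroup (Fin N → ℚ))

theorem dot_add {N : ℕ} (ω : Fin N → ℝ) (α β : Fin N → ℚ) :
    dot ω (α + β) = dot ω α + dot ω β := by
  simp [dot, mul_add, Finset.sum_add_distrib]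

theorem dot_zero {N : ℕ} (ω : Fin N → ℝ) : dot ω 0 = 0 := by simp [dot]

theorem dot_neg {N : ℕ} (ω : Fin N → ℝ) (α : Fin N → ℚ) : dot ω (-α) = -dot ω α := by
  simp [dot]

/-- The order on `ℚ^N` induced by `ω`. When the coordinates of `ω` are rationally independent this
is the total order `α ≤ β ↔ ω · α ≤ ω · β`, see `Expo.le_iff_dot_le`. -/
instance {N : ℕ} (ω : Fin N → ℝ) : PartialOrder (Expo ω) where
  le α β := α = β ∨ dot ω α < dot ω β
  le_refl _ := Or.inl rfl
  le_trans α β γ := by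
    rintro (rfl | h) (rfl | h')
    · exact Or.inl rfl
    · exact Or.inr h'
    · exact Or.inr h
    · exact Or.inr (h.trans h')
  le_antisymm α β := by
    rintro (rfl | h) (h' | h')
    · rfl
    · rfl
    · exact h'.symm
    · exact absurd (h.trans h') (lt_irrefl _)

theorem Expo.le_def {N : ℕ} {ω : Fin N → ℝ} (α β : Expo ω) :
    α ≤ β ↔ α = β ∨ dot ω α < dot ω β := Iff.rfl

instance {N : ℕ} (ω : Fin N → ℝ) : IsOrderedCancelAddMonoid (Expo ω) where
  add_le_add_left α β h γ := by
    rcases h with rfl | h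
    · exact le_rfl
    · refine Or.inr ?_
      have h1 := dot_add ω α γ
      have h2 := dot_add ω β γ
      change dot ω (Add.add (α : Fin N → ℚ) γ) < dot ω (Add.add (β : Fin N → ℚ) γ)
      change dot ω (Add.add (α : Fin N → ℚ) γ) = _ at h1
      change dot ω (Add.add (β : Fin N → ℚ) γ) = _ at h2
      linarith
  le_of_add_le_add_left α β γ h := by
    rcases h with h | h
    · exact Or.inl (add_left_cancel h)
    · refine Or.inr ?_
      have h1 := dot_add ω α β
      have h2 := dot_add ω α γ
      change dot ω (Add.add (α : Fin N → ℚ) β) < dot ω (Add.add (α : Fin N → ℚ) γ) at h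
      change dot ω (Add.add (α : Fin N → ℚ) β) = _ at h1
      change dot ω (Add.add (α : Fin N → ℚ) γ) = _ at h2
      linarith

theorem dot_injective {N : ℕ} {ω : Fin N → ℝ} (hω : LinearIndependent ℚ ω) :
    Function.Injective (dot ω) := by
  intro α β h
  have h0 : ∑ i, (α i - β i) • ω i = 0 := by
    have : ∑ i, (α i - β i) • ω i = dot ω α - dot ω β := by
      rw [dot, dot, ← Finset.sum_sub_distrib]
      refine Finset.sum_congr rfl fun i _ => ?_
      rw [Rat.smul_def]
      push_cast
      ring
    rw [this, h, sub_self]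
  funext i
  exact sub_eq_zero.mp (Fintype.linearIndependent_iff.mp hω _ h0 i)

theorem Expo.le_iff_dot_le {N : ℕ} {ω : Fin N → ℝ} (hω : LinearIndependent ℚ ω) (α β : Expo ω) :
    α ≤ β ↔ dot ω α ≤ dot ω β := by
  rw [Expo.le_def]
  constructor
  · rintro (rfl | h)
    · exact le_rfl
    · exact h.le
  · intro h
    rcases h.eq_or_lt with h | h
    · exact Or.inl (dot_injective hω h)
    · exact Or.inr h

/-! ### `ω`-positive Puiseux series -/

/-- `σ` is a convex rational polyhedral cone: the set of non-negative real combinations of finitely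
many vectors of `ℚ^N`. -/
def IsRationalCone {N : ℕ} (σ : PointedCone ℝ (Fin N → ℝ)) : Prop :=
  ∃ s : Finset (Fin N → ℚ), σ = PointedCone.hull ℝ (toReal '' (s : Set (Fin N → ℚ)))

/-- `σ` is `ω`-positive: `v · ω ≥ 0` for all `v ∈ σ`. -/
def IsPositiveCone {N : ℕ} (ω : Fin N → ℝ) (σ : PointedCone ℝ (Fin N → ℝ)) : Prop :=
  ∀ v ∈ σ, 0 ≤ ∑ i, ω i * v i

/-- The set of exponents `E` is contained in a lattice `(1/k) ℤ^N`. -/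
def InLattice {N : ℕ} (E : Set (Fin N → ℚ)) : Prop :=
  ∃ k : ℕ, 0 < k ∧ ∀ α ∈ E, ∀ i, ∃ m : ℤ, α i = (m : ℚ) / (k : ℚ)

/-- Some rational translate of the set of exponents `E` is contained in an `ω`-positive convex
rational polyhedral cone. -/
def InPositiveCone {N : ℕ} (ω : Fin N → ℝ) (E : Set (Fin N → ℚ)) : Prop :=
  ∃ (γ : Fin N → ℚ) (σ : PointedCone ℝ (Fin N → ℝ)), IsRationalCone σ ∧ IsPositiveCone ω σ ∧
    ∀ α ∈ E, toReal (α + γ) ∈ σ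

/-- `E` may be the set of exponents of an `ω`-positive Puiseux series. -/
def Admissible {N : ℕ} (ω : Fin N → ℝ) (E : Set (Fin N → ℚ)) : Prop :=
  InLattice E ∧ InPositiveCone ω E

theorem toReal_add {N : ℕ} (α β : Fin N → ℚ) : toReal (α + β) = toReal α + toReal β := by
  funext i; simp [toReal]

theorem Admissible.mono {N : ℕ} {ω : Fin N → ℝ} {E F : Set (Fin N → ℚ)} (h : E ⊆ F)
    (hF : Admissible ω F) : Admissible ω E := by
  obtain ⟨⟨k, hk, hl⟩, γ, σ, h1, h2, h3⟩ := hF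
  exact ⟨⟨k, hk, fun α hα => hl α (h hα)⟩, γ, σ, h1, h2, fun α hα => h3 α (h hα)⟩

theorem isRationalCone_hull {N : ℕ} (s : Finset (Fin N → ℚ)) :
    IsRationalCone (PointedCone.hull ℝ (toReal '' (s : Set (Fin N → ℚ)))) := ⟨s, rfl⟩

theorem IsRationalCone.sup {N : ℕ} {σ τ : PointedCone ℝ (Fin N → ℝ)} (hσ : IsRationalCone σ)
    (hτ : IsRationalCone τ) : IsRationalCone (σ ⊔ τ) := by
  classical
  obtain ⟨s, rfl⟩ := hσ
  obtain ⟨t, rfl⟩ := hτ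
  refine ⟨s ∪ t, ?_⟩
  rw [Finset.coe_union, Set.image_union]
  exact (Submodule.span_union _ _).symm

theorem IsPositiveCone.sup {N : ℕ} {ω : Fin N → ℝ} {σ τ : PointedCone ℝ (Fin N → ℝ)}
    (hσ : IsPositiveCone ω σ) (hτ : IsPositiveCone ω τ) : IsPositiveCone ω (σ ⊔ τ) := by
  intro v hv
  obtain ⟨a, ha, b, hb, rfl⟩ := Submodule.mem_sup.mp hv
  have := add_nonneg (hσ a ha) (hτ b hb)
  simpa [mul_add, Finset.sum_add_distrib] using this

theorem isPositiveCone_hull {N : ℕ} {ω : Fin N → ℝ} {s : Finset (Fin N → ℚ)}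
    (h : ∀ v ∈ s, 0 ≤ dot ω v) :
    IsPositiveCone ω (PointedCone.hull ℝ (toReal '' (s : Set (Fin N → ℚ)))) := by
  intro v hv
  induction hv using Submodule.span_induction with
  | mem x hx =>
    obtain ⟨v, hv, rfl⟩ := hx
    exact h v hv
  | zero => simp
  | add x y _ _ hx hy => simpa [mul_add, Finset.sum_add_distrib] using add_nonneg hx hy
  | smul a x _ hx =>
    have : ∑ i, ω i * (a • x) i = (a : ℝ) * ∑ i, ω i * x i := by
      rw [Finset.mul_sum]
      refine Finset.sum_congr rfl fun i _ => ?_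
      change ω i * ((a : ℝ) * x i) = _
      ring
    rw [this]
    exact mul_nonneg a.2 hx

theorem admissible_singleton {N : ℕ} (ω : Fin N → ℝ) (α : Fin N → ℚ) : Admissible ω {α} := by
  constructor
  · refine ⟨∏ i, (α i).den, Finset.prod_pos fun i _ => (α i).den_pos, ?_⟩
    intro β hβ i
    rw [Set.mem_singleton_iff.mp hβ]
    obtain ⟨c, hc⟩ := Finset.dvd_prod_of_mem (fun i => (α i).den) (Finset.mem_univ i)
    have hd : ((∏ i, (α i).den : ℕ) : ℚ) ≠ 0 := by
      exact_mod_cast (Finset.prod_pos fun i _ => (α i).den_pos).ne'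
    refine ⟨(α i).num * c, ?_⟩
    rw [eq_div_iff hd, hc]
    have := Rat.mul_den_eq_num (α i)
    push_cast
    rw [← this]
    ring
  · refine ⟨-α, ⊥, ⟨∅, by simp⟩, ?_, ?_⟩
    · intro v hv
      rw [Submodule.mem_bot] at hv
      simp [hv]
    · intro β hβ
      rw [Set.mem_singleton_iff.mp hβ, Submodule.mem_bot]
      funext i
      simp [toReal]

theorem InLattice.common {N : ℕ} {E F : Set (Fin N → ℚ)} (hE : InLattice E) (hF : InLattice F) :
    ∃ k : ℕ, 0 < k ∧ (∀ α ∈ E, ∀ i, ∃ m : ℤ, α i = (m : ℚ) / (k : ℚ)) ∧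
      ∀ α ∈ F, ∀ i, ∃ m : ℤ, α i = (m : ℚ) / (k : ℚ) := by
  obtain ⟨k, hk, h⟩ := hE
  obtain ⟨l, hl, h'⟩ := hF
  have hk' : (k : ℚ) ≠ 0 := by exact_mod_cast hk.ne'
  have hl' : (l : ℚ) ≠ 0 := by exact_mod_cast hl.ne'
  refine ⟨k * l, Nat.mul_pos hk hl, fun α hα i => ?_, fun α hα i => ?_⟩
  · obtain ⟨m, hm⟩ := h α hα i
    exact ⟨m * l, by rw [hm]; push_cast; field_simp⟩
  · obtain ⟨m, hm⟩ := h' α hα i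
    exact ⟨m * k, by rw [hm]; push_cast; field_simp⟩

theorem Admissible.union {N : ℕ} {ω : Fin N → ℝ} {E F : Set (Fin N → ℚ)} (hE : Admissible ω E)
    (hF : Admissible ω F) : Admissible ω (E ∪ F) := by
  constructor
  · obtain ⟨k, hk, h1, h2⟩ := hE.1.common hF.1
    exact ⟨k, hk, fun α hα => hα.elim (h1 α) (h2 α)⟩
  · obtain ⟨γ, σ, h1, h2, h3⟩ := hE.2
    obtain ⟨δ, τ, h1', h2', h3'⟩ := hF.2
    have key : ∀ {E F : Set (Fin N → ℚ)} {γ δ : Fin N → ℚ} {σ τ : PointedCone ℝ (Fin N → ℝ)},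
        IsRationalCone σ → IsPositiveCone ω σ → (∀ α ∈ E, toReal (α + γ) ∈ σ) →
        IsRationalCone τ → IsPositiveCone ω τ → (∀ α ∈ F, toReal (α + δ) ∈ τ) →
        dot ω δ ≤ dot ω γ → InPositiveCone ω (E ∪ F) := by
      intro E F γ δ σ τ h1 h2 h3 h1' h2' h3' h
      refine ⟨γ, (σ ⊔ τ) ⊔ PointedCone.hull ℝ (toReal '' ((({γ - δ} : Finset (Fin N → ℚ))) :
        Set (Fin N → ℚ))), (h1.sup h1').sup (isRationalCone_hull _), (h2.sup h2').sup
        (isPositiveCone_hull ?_), ?_⟩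
      · intro v hv
        rw [Finset.mem_singleton] at hv
        rw [hv, sub_eq_add_neg, dot_add, dot_neg]
        linarith
      · rintro α (hα | hα)
        · exact Submodule.mem_sup_left (Submodule.mem_sup_left (h3 α hα))
        · have : α + γ = (α + δ) + (γ - δ) := by abel
          rw [this, toReal_add]
          refine Submodule.add_mem _ (Submodule.mem_sup_left (Submodule.mem_sup_right (h3' α hα)))
            (Submodule.mem_sup_right (Submodule.subset_span ⟨γ - δ, by simp, rfl⟩))
    rcases le_total (dot ω δ) (dot ω γ) with h | h
    · exact key h1 h2 h3 h1' h2' h3' h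
    · rw [Set.union_comm]
      exact key h1' h2' h3' h1 h2 h3 h

theorem Admissible.add {N : ℕ} {ω : Fin N → ℝ} {E F G : Set (Fin N → ℚ)} (hE : Admissible ω E)
    (hF : Admissible ω F) (hG : ∀ g ∈ G, ∃ e ∈ E, ∃ f ∈ F, e + f = g) : Admissible ω G := by
  constructor
  · obtain ⟨k, hk, h1, h2⟩ := hE.1.common hF.1
    refine ⟨k, hk, fun α hα i => ?_⟩
    obtain ⟨e, he, f, hf, rfl⟩ := hG α hα
    obtain ⟨m, hm⟩ := h1 e he i
    obtain ⟨n, hn⟩ := h2 f hf i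
    exact ⟨m + n, by rw [Pi.add_apply, hm, hn]; push_cast; ring⟩
  · obtain ⟨γ, σ, h1, h2, h3⟩ := hE.2
    obtain ⟨δ, τ, h1', h2', h3'⟩ := hF.2
    refine ⟨γ + δ, σ ⊔ τ, h1.sup h1', h2.sup h2', fun α hα => ?_⟩
    obtain ⟨e, he, f, hf, rfl⟩ := hG α hα
    have : e + f + (γ + δ) = (e + γ) + (f + δ) := by abel
    rw [this, toReal_add]
    exact Submodule.add_mem_sup (h3 e he) (h3' f hf)

/-- Over an admissible set `E`, only finitely many `α ∈ E` satisfy `ω · α ≤ c`. -/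
theorem Admissible.finite_le {N : ℕ} {ω : Fin N → ℝ} (hω : LinearIndependent ℚ ω)
    {E : Set (Fin N → ℚ)} (hE : Admissible ω E) (c : ℝ) : {α ∈ E | dot ω α ≤ c}.Finite := by
  obtain ⟨⟨k, hk, hl⟩, γ, σ, ⟨s, rfl⟩, h2, h3⟩ := hE
  have hs : ∀ v ∈ s, 0 ≤ dot ω v := fun v hv => h2 _ (Submodule.subset_span ⟨v, hv, rfl⟩)
  set C : ℝ := c + dot ω γ with hC
  let B : Fin N → ℝ := fun i => ∑ v ∈ s, C / dot ω v * |(v i : ℝ)| + |(γ i : ℝ)|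
  have hbound : ∀ α ∈ {α ∈ E | dot ω α ≤ c}, ∀ i, |(α i : ℝ)| ≤ B i := by
    rintro α ⟨hα, hc⟩ i
    obtain ⟨a, ha⟩ := (Submodule.mem_span_image_finset_iff_exists_fun' _).mp (h3 α hα)
    have hcoord : ∀ j, ((α + γ) j : ℝ) = ∑ v ∈ s, (a v : ℝ) * (v j : ℝ) := by
      intro j
      have := congrFun ha j
      rw [Finset.sum_apply] at this
      exact this.symm
    have hdot : ∑ v ∈ s, (a v : ℝ) * dot ω v ≤ C := by
      have : dot ω (α + γ) = ∑ v ∈ s, (a v : ℝ) * dot ω v := by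
        simp only [dot, hcoord, Finset.mul_sum]
        rw [Finset.sum_comm]
        exact Finset.sum_congr rfl fun v _ => Finset.sum_congr rfl fun j _ => by ring
      rw [← this, dot_add, hC]
      linarith
    have hterm : ∀ v ∈ s, (a v : ℝ) * |(v i : ℝ)| ≤ C / dot ω v * |(v i : ℝ)| := by
      intro v hv
      by_cases hv0 : v = 0
      · simp [hv0]
      · have hpos : 0 < dot ω v := lt_of_le_of_ne (hs v hv) fun h =>
          hv0 (dot_injective hω (h.symm.trans (dot_zero ω).symm))
        refine mul_le_mul_of_nonneg_right ?_ (abs_nonneg _)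
        rw [le_div_iff₀ hpos]
        exact (Finset.single_le_sum (f := fun v => (a v : ℝ) * dot ω v)
          (fun w hw => mul_nonneg (a w).2 (hs w hw)) hv).trans hdot
    have h4 : |((α + γ) i : ℝ)| ≤ ∑ v ∈ s, C / dot ω v * |(v i : ℝ)| := by
      rw [hcoord]
      refine (Finset.abs_sum_le_sum_abs _ _).trans (Finset.sum_le_sum fun v hv => ?_)
      rw [abs_mul, abs_of_nonneg (a v).2]
      exact hterm v hv
    have h5 : (α i : ℝ) = ((α + γ) i : ℝ) - γ i := by simp
    rw [h5]
    exact (abs_sub _ _).trans (add_le_add_left h4 _)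
  have hk' : (0 : ℝ) < k := by exact_mod_cast hk
  have hfin : (Set.univ.pi fun i : Fin N => Set.Icc (-⌈B i * k⌉) ⌈B i * k⌉).Finite :=
    Set.Finite.pi fun i => Set.finite_Icc _ _
  refine (hfin.image fun m : Fin N → ℤ => fun i => (m i : ℚ) / (k : ℚ)).subset ?_
  intro α hα
  choose m hm using hl α hα.1
  refine ⟨m, fun i _ => ?_, funext fun i => (hm i).symm⟩
  have h6 : |(m i : ℝ)| ≤ B i * k := by
    have h7 := hbound α hα i
    rw [hm i] at h7
    push_cast at h7
    rwa [abs_div, abs_of_pos hk', div_le_iff₀ hk'] at h7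
  obtain ⟨h8, h9⟩ := abs_le.mp h6
  have h10 := Int.le_ceil (B i * k)
  constructor
  · have : ((-⌈B i * k⌉ : ℤ) : ℝ) ≤ m i := by push_cast; linarith
    exact_mod_cast this
  · have : (m i : ℝ) ≤ (⌈B i * k⌉ : ℤ) := by linarith
    exact_mod_cast this

theorem Admissible.isPWO {N : ℕ} {ω : Fin N → ℝ} (hω : LinearIndependent ℚ ω)
    {E : Set (Expo ω)} (hE : Admissible ω E) : E.IsPWO := by
  intro f
  by_cases h : ∃ n, 0 < n ∧ (f 0 : Expo ω) ≤ f n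
  · obtain ⟨n, hn, h⟩ := h
    exact ⟨0, n, hn, h⟩
  · push Not at h
    have hfin := Admissible.finite_le hω hE (dot ω (f 0 : Expo ω))
    have hmem : ∀ n, (f n : Expo ω) ∈
        {α : Fin N → ℚ | α ∈ (E : Set (Fin N → ℚ)) ∧ dot ω α ≤ dot ω (f 0 : Expo ω)} := by
      intro n
      refine ⟨(f n).2, ?_⟩
      rcases Nat.eq_zero_or_pos n with rfl | hn
      · exact le_rfl
      · by_contra! hlt
        exact h n hn (Or.inr hlt)
    obtain ⟨m, n, hmn, heq⟩ := Set.Finite.exists_lt_map_eq_of_forall_mem hmem hfin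
    exact ⟨m, n, hmn, Or.inl heq⟩

open scoped Pointwise in
/-- The ring of `ω`-positive Puiseux series with coefficients in `K`, with the usual
sum and (convolution) product of series. The well-ordered support that is built into Hahn series is
no extra condition when the coordinates of `ω` are rationally independent, see
`Admissible.isPWO`. -/
def puiseux {N : ℕ} (ω : Fin N → ℝ) (K : Type*) [Field K] : Subring (HahnSeries (Expo ω) K) where
  carrier := {φ | Admissible ω φ.support}
  mul_mem' {a b} ha hb := by
    classical
    refine Admissible.add ha hb fun g hg => ?_
    have hg' : (g : Expo ω) ∈ a.support + b.support :=
      HahnSeries.support_mul_subset (Γ := Expo ω) (x := a) (y := b) hg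
    obtain ⟨e, he, f, hf, h⟩ := Set.mem_add.mp hg'
    exact ⟨e, he, f, hf, h⟩
  one_mem' :=
    (admissible_singleton ω 0).mono
      (HahnSeries.support_single_subset (Γ := Expo ω) (R := K) (a := 0) (r := 1))
  add_mem' {a b} ha hb := (Admissible.union ha hb).mono (HahnSeries.support_add_subset a b)
  zero_mem' := by
    refine (admissible_singleton ω 0).mono ?_
    intro α hα
    exact absurd rfl hα
  neg_mem' {a} ha := by
    change Admissible ω (-a).support
    rw [HahnSeries.support_neg]
    exact ha

/-- The field `S_ω` of `ω`-positive Puiseux series. -/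
abbrev S {N : ℕ} (ω : Fin N → ℝ) (K : Type*) [Field K] : Type _ := puiseux ω K

/-- The monomial `c x^α`. -/
def monomialSeries {N : ℕ} (ω : Fin N → ℝ) {K : Type*} [Field K] (α : Expo ω) (c : K) : S ω K :=
  ⟨HahnSeries.single α c,
    Admissible.mono (HahnSeries.support_single_subset (Γ := Expo ω) (a := α) (r := c))
      (admissible_singleton ω α)⟩

/-- The order `ord_ω φ` of a series: the least `ω · α` for `α` an exponent of `φ`
(see `ord_isLeast`), and `∞` for `φ = 0`. -/
def ord {N : ℕ} {ω : Fin N → ℝ} {K : Type*} [Field K] (φ : S ω K) : WithTop ℝ :=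
  (φ : HahnSeries (Expo ω) K).orderTop.map fun α : Expo ω => dot ω α

/-- The first term `c_α x^α` of a series, with `ω · α = ord_ω φ`; it is `0` for `φ = 0`. -/
def firstTerm {N : ℕ} {ω : Fin N → ℝ} {K : Type*} [Field K] (φ : S ω K) : S ω K :=
  monomialSeries ω (φ : HahnSeries (Expo ω) K).order
    ((φ : HahnSeries (Expo ω) K).coeff (φ : HahnSeries (Expo ω) K).order)

/-! ### Weighted orders, initial parts and initial ideals -/

/-- The weight `η · β` of the monomial `y^β`, with `0 · ∞ = 0` and `n · ∞ = ∞` for `n > 0`. -/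
def weight {M : ℕ} (η : Fin M → WithTop ℝ) (β : Fin M →₀ ℕ) : WithTop ℝ := ∑ i, β i • η i

/-- The `η`-order of a polynomial in `S_ω[y]` (it is `∞` for the polynomial `0`). -/
def polyOrd {N M : ℕ} {ω : Fin N → ℝ} {K : Type*} [Field K] (η : Fin M → WithTop ℝ)
    (f : MvPolynomial (Fin M) (S ω K)) : WithTop ℝ :=
  f.support.inf fun β => ord (f.coeff β) + weight η β

open Classical in
/-- The `η`-initial part of a polynomial in `S_ω[y]` (it is `0` if the `η`-order is `∞`). -/
def initPart {N M : ℕ} {ω : Fin N → ℝ} {K : Type*} [Field K] (η : Fin M → WithTop ℝ)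
    (f : MvPolynomial (Fin M) (S ω K)) : MvPolynomial (Fin M) (S ω K) :=
  if polyOrd η f = ⊤ then 0 else
    ∑ β ∈ f.support with ord (f.coeff β) + weight η β = polyOrd η f,
      MvPolynomial.monomial β (firstTerm (f.coeff β))

/-- The `η`-initial ideal of an ideal of `S_ω[y]`: it is generated by the `η`-initial parts of the
elements of the ideal and by the `y_i` with `η_i = ∞`. -/
def initIdeal {N M : ℕ} {ω : Fin N → ℝ} {K : Type*} [Field K] (η : Fin M → WithTop ℝ)
    (I : Ideal (MvPolynomial (Fin M) (S ω K))) : Ideal (MvPolynomial (Fin M) (S ω K)) :=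
  Ideal.span ({g | ∃ f ∈ I, g = initPart η f} ∪ {g | ∃ i, η i = ⊤ ∧ g = MvPolynomial.X i})

/-- The set of common zeroes in `S_ω^M` of an ideal of `S_ω[y]`. -/
def zeroes {N M : ℕ} {ω : Fin N → ℝ} {K : Type*} [Field K]
    (I : Ideal (MvPolynomial (Fin M) (S ω K))) : Set (Fin M → S ω K) :=
  {φ | ∀ f ∈ I, MvPolynomial.eval φ f = 0}

/-- The torus `T_η`: non-zero entries where `η_i` is finite, and zero entries where `η_i = ∞`. -/
def torus {N M : ℕ} (ω : Fin N → ℝ) (K : Type*) [Field K] (η : Fin M → WithTop ℝ) :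
    Set (Fin M → S ω K) :=
  {φ | (∀ i, η i ≠ ⊤ → φ i ≠ 0) ∧ ∀ i, η i = ⊤ → φ i = 0}

/-! ### Consistency of the definitions -/

theorem ord_isLeast {N : ℕ} {ω : Fin N → ℝ} {K : Type*} [Field K]
    (φ : S ω K) (hφ : φ ≠ 0) :
    ord φ = (dot ω (φ : HahnSeries (Expo ω) K).order : ℝ) ∧
      IsLeast (dot ω '' (φ : HahnSeries (Expo ω) K).support)
        (dot ω (φ : HahnSeries (Expo ω) K).order) := by
  have h0 : (φ : HahnSeries (Expo ω) K) ≠ 0 := fun h => hφ (Subtype.ext h)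
  refine ⟨?_, ⟨_, ?_, rfl⟩, ?_⟩
  · rw [ord, ← HahnSeries.order_eq_orderTop_of_ne_zero h0]
    rfl
  · exact fun h => h0 (HahnSeries.coeff_order_eq_zero.mp h)
  · rintro _ ⟨α, hα, rfl⟩
    rw [HahnSeries.order_of_ne h0]
    by_contra! hlt
    exact (φ : HahnSeries (Expo ω) K).isWF_support.not_lt_min
      (HahnSeries.support_nonempty_iff.2 h0) hα
      (lt_of_le_of_ne (Or.inr hlt) fun h => (h ▸ hlt).false)

theorem ord_zero {N : ℕ} {ω : Fin N → ℝ} {K : Type*} [Field K] : ord (0 : S ω K) = ⊤ := by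
  simp [ord]

end

end OmegaPuiseux

namespace OmegaPuiseux

/-! The two implications rest on different facts.

From a zero of the ideal to a zero of the initial ideal, everything is graded bookkeeping. If `ψ`
has order `η` and first terms `φ`, then the part of `f` of weighted order `p`, evaluated at `φ`, is
the part of order `p` of `f(ψ)` (`eval_levelPart`). Hence initial parts of elements of the ideal
vanish at `φ`.

The converse needs the Nullstellensatz. Suppose no zero `ψ` of `I` has order `η` and first terms
`φ`. Each zero then has a coordinate `i` for which the initial part of `y_i - ψ_i` does not vanish
at `φ` (`X_sub_C_mem_nonvanishingInit`). There are finitely many zeroes, so the product of these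
linear polynomials exists; it vanishes on all zeroes, and some power of it lies in `I`. Initial
parts are multiplicative and the series form a domain, so the initial part of that power is nonzero
at `φ`, and `φ` is no zero of the initial ideal.

The Nullstellensatz requires the series to form an algebraically closed field (`isField_S`,
`exists_root_of_monic`). Roots are found by Newton–Puiseux induction on the degree: remove the
subleading coefficient, rescale by a monomial until the residue polynomial over `K` is not a power
of `X`, split it into coprime factors and lift the splitting by Hensel's lemma. Admissibility of
supports is preserved because non-negative admissible exponents lie in an admissible monoid `P`
(`Admissible.exists_addSubmonoid`), and both Hensel lifting and inversion stay inside `P`. -/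

theorem exists_wellFounded_recursion {α β : Type*} [Inhabited β] {r : α → α → Prop}
    (hr : WellFounded r) (step : α → (α → β) → β) :
    ∃ f : α → β, ∀ a, f a = step a (open Classical in fun b => if r b a then f b else default) := by
  classical
  -- Outside the `r`-predecessors of `a` the recursion sees `default`, so `step` may be an arbitrary
  -- function; its users must check that it reads only predecessors.
  refine ⟨hr.fix fun a F => step a fun b => if h : r b a then F b h else default, fun a => ?_⟩
  rw [hr.fix_eq]
  rfl

/-! ### Hensel's lemma for series with exponents in a monoid -/

section SeriesOn

variable {Γ : Type*} [PartialOrder Γ]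

/-- The series `∑ p ∈ P, a p x^p`. -/
noncomputable def seriesOn {R : Type*} [Zero R] (P : Set Γ) (hw : P.IsPWO) (a : Γ → R) :
    HahnSeries Γ R where
  coeff := open Classical in fun p => if p ∈ P then a p else 0
  isPWO_support' := hw.mono fun p hp => by
    by_contra h
    exact hp (if_neg h)

theorem support_seriesOn_subset {R : Type*} [Zero R] (P : Set Γ) (hw : P.IsPWO) (a : Γ → R) :
    (seriesOn P hw a).support ⊆ P := fun p hp => by
  by_contra h
  exact hp (if_neg h)

theorem seriesOn_coeff {R : Type*} [Zero R] {P : Set Γ} (hw : P.IsPWO) (a : Γ → R) {p : Γ}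
    (hp : p ∈ P) : (seriesOn P hw a).coeff p = a p := if_pos hp

theorem seriesOn_coeff_of_notMem {R : Type*} [Zero R] {P : Set Γ} (hw : P.IsPWO) (a : Γ → R)
    {p : Γ} (hp : p ∉ P) : (seriesOn P hw a).coeff p = 0 := if_neg hp

end SeriesOn

section Hensel

open Polynomial

variable {K : Type*} [Field K]

/-- A Bézout relation solves the equation without degree bounds. Reducing `u` modulo the monic `g`
moves the quotient into `v`; then `g * v = c - u * h` has degree below that of `g * h`, which bounds
`v`. -/
theorem exists_mul_add_mul_eq_of_isCoprime {g h : K[X]} (hg : g.Monic) (hgh : IsCoprime g h)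
    {c : K[X]} (hc : c.degree < (g * h).degree) :
    ∃ u v : K[X], u.degree < g.degree ∧ v.degree < h.degree ∧ u * h + g * v = c := by
  obtain ⟨a, b, hab⟩ := hgh
  have key : (c * b %ₘ g) * h + g * (c * a + (c * b /ₘ g) * h) = c := by
    have := modByMonic_add_div (c * b) g
    linear_combination h * this + c * hab
  refine ⟨_, _, degree_modByMonic_lt _ hg, ?_, key⟩
  have hu := degree_modByMonic_lt (c * b) hg
  by_contra! hv
  have hh : h ≠ 0 := by
    rintro rfl
    simp at hc
  have h1 : ((c * b %ₘ g) * h).degree < (g * h).degree := by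
    rw [degree_mul, degree_mul]
    exact WithBot.add_lt_add_right (degree_ne_bot.mpr hh) hu
  have h2 : (g * (c * a + (c * b /ₘ g) * h)).degree < (g * h).degree := by
    rw [← eq_sub_iff_add_eq'] at key
    rw [key]
    exact (degree_sub_le _ _).trans_lt (max_lt hc h1)
  rw [degree_mul, degree_mul] at h2
  exact absurd h2 (not_lt.mpr (by gcongr))

variable {Γ : Type*} [AddCommGroup Γ] [PartialOrder Γ] [IsOrderedCancelAddMonoid Γ]

/-- Lifting of a coprime factorization, on the level of the coefficients of a series with
coefficients in `K[X]`. -/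
theorem exists_factor_coeffs {P : AddSubmonoid Γ} (hP : ∀ p ∈ P, 0 ≤ p)
    (hw : (P : Set Γ).IsPWO) {g h : K[X]} (hg : g.Monic) (hgh : IsCoprime g h)
    (F : Γ → K[X]) (hF0 : F 0 = g * h) (hF : ∀ p ≠ 0, (F p).degree < (g * h).degree) :
    ∃ G H : Γ → K[X], G 0 = g ∧ H 0 = h ∧ (∀ p ≠ 0, (G p).degree < g.degree) ∧
      (∀ p ≠ 0, (H p).degree < h.degree) ∧
      ∀ p ∈ P, ∑ x ∈ Finset.antidiagonal hw hw p, G x.1 * H x.2 = F p := by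
  classical
  -- The solution is required only under the degree bound, which makes `sol` total. The bound for
  -- the actual arguments is established in `hdeg` by induction.
  have hsol : ∀ c : K[X], ∃ w : K[X] × K[X], c.degree < (g * h).degree →
      w.1.degree < g.degree ∧ w.2.degree < h.degree ∧ w.1 * h + g * w.2 = c := by
    intro c
    by_cases hc : c.degree < (g * h).degree
    · obtain ⟨u, v, h1⟩ := exists_mul_add_mul_eq_of_isCoprime hg hgh hc
      exact ⟨(u, v), fun _ => h1⟩
    · exact ⟨0, fun h => absurd h hc⟩
  choose sol hsol using hsol
  have hwf := Set.wellFoundedOn_iff.mp hw.isWF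
  -- The coefficient equation at `p ≠ 0` is linear in the unknowns at `p`: `G p * h + g * H p`
  -- equals `F p` minus products whose two indices are nonzero, hence positive and smaller than `p`.
  obtain ⟨f, hf⟩ := exists_wellFounded_recursion hwf (β := K[X] × K[X])
    (fun p r => if p = 0 then (g, h) else sol (F p -
      ∑ x ∈ Finset.antidiagonal hw hw p with x.1 ≠ 0 ∧ x.2 ≠ 0, (r x.1).1 * (r x.2).2))
  have hf0 : f 0 = (g, h) := by rw [hf, if_pos rfl]
  have hfp : ∀ p ≠ 0, f p = sol (F p -
      ∑ x ∈ Finset.antidiagonal hw hw p with x.1 ≠ 0 ∧ x.2 ≠ 0, (f x.1).1 * (f x.2).2) := by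
    intro p hp
    rw [hf, if_neg hp]
    congr 2
    refine Finset.sum_congr rfl fun x hx => ?_
    obtain ⟨hx, hx1, hx2⟩ := Finset.mem_filter.mp hx
    obtain ⟨h1, h2, rfl⟩ := Finset.mem_antidiagonal.mp hx
    have hx1' := lt_of_le_of_ne (hP _ h1) hx1.symm
    have hx2' := lt_of_le_of_ne (hP _ h2) hx2.symm
    beta_reduce
    rw [if_pos ⟨lt_add_of_pos_right _ hx2', h1, P.add_mem h1 h2⟩,
      if_pos ⟨lt_add_of_pos_left _ hx1', h2, P.add_mem h1 h2⟩]
  have hdeg : ∀ p ≠ 0, (f p).1.degree < g.degree ∧ (f p).2.degree < h.degree ∧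
      (f p).1 * h + g * (f p).2 = F p -
      ∑ x ∈ Finset.antidiagonal hw hw p with x.1 ≠ 0 ∧ x.2 ≠ 0, (f x.1).1 * (f x.2).2 := by
    intro p
    induction p using hwf.induction with
    | _ p ih =>
    intro hp
    rw [hfp p hp]
    refine hsol _ ((degree_sub_le _ _).trans_lt (max_lt (hF p hp) ?_))
    refine (degree_sum_le _ _).trans_lt ((Finset.sup_lt_iff ?_).mpr fun x hx => ?_)
    · exact (bot_le.trans_lt (hF p hp))
    obtain ⟨hx, hx1, hx2⟩ := Finset.mem_filter.mp hx
    obtain ⟨h1, h2, rfl⟩ := Finset.mem_antidiagonal.mp hx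
    have hx1' := lt_of_le_of_ne (hP _ h1) hx1.symm
    have hx2' := lt_of_le_of_ne (hP _ h2) hx2.symm
    have d1 := (ih _ ⟨lt_add_of_pos_right _ hx2', h1, P.add_mem h1 h2⟩ hx1).1
    have d2 := (ih _ ⟨lt_add_of_pos_left _ hx1', h2, P.add_mem h1 h2⟩ hx2).2.1
    rw [degree_mul, degree_mul]
    exact (add_le_add_right d2.le _).trans_lt
      (WithBot.add_lt_add_right (bot_le.trans_lt d2).ne' d1)
  refine ⟨fun p => (f p).1, fun p => (f p).2, by simp [hf0], by simp [hf0],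
    fun p hp => (hdeg p hp).1, fun p hp => (hdeg p hp).2.1, fun p hpP => ?_⟩
  by_cases hp : p = 0
  · subst hp
    rw [Finset.sum_eq_single (0, 0)]
    · simp [hf0, hF0]
    · rintro ⟨a, b⟩ hab hne
      obtain ⟨h1, h2, h3⟩ := Finset.mem_antidiagonal.mp hab
      exact absurd (Prod.ext_iff.mpr
        ((add_eq_zero_iff_of_nonneg (hP _ h1) (hP _ h2)).mp h3)) hne
    · intro hn
      exact absurd (Finset.mem_antidiagonal.mpr ⟨hpP, hpP, add_zero _⟩) hn
  · rw [← Finset.sum_filter_add_sum_filter_not _ (fun x : Γ × Γ => x.1 ≠ 0 ∧ x.2 ≠ 0)]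
    -- The remaining pairs contribute exactly the linear terms `G p * h` and `g * H p`.
    have hrest : (Finset.antidiagonal hw hw p).filter (fun x => ¬(x.1 ≠ 0 ∧ x.2 ≠ 0)) =
        {(p, 0), (0, p)} := by
      ext ⟨a, b⟩
      simp only [Finset.mem_filter, Finset.mem_antidiagonal, Finset.mem_insert,
        Finset.mem_singleton, Prod.mk.injEq, SetLike.mem_coe]
      constructor
      · rintro ⟨⟨_, _, rfl⟩, h⟩
        by_cases ha : a = 0
        · simp [ha]
        · have hb : b = 0 := by tauto
          simp [hb]
      · rintro (⟨rfl, rfl⟩ | ⟨rfl, rfl⟩)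
        · exact ⟨⟨hpP, P.zero_mem, add_zero _⟩, by simp⟩
        · exact ⟨⟨P.zero_mem, hpP, zero_add _⟩, by simp⟩
    rw [hrest, Finset.sum_pair (by simp [hp])]
    have := (hdeg p hp).2.2
    simp only [hf0]
    linear_combination this

/-- The product of series supported in `s` and `t`, computed over `s` and `t`. -/
theorem coeff_mul_of_support_subset {R : Type*} [NonUnitalNonAssocSemiring R]
    {x y : HahnSeries Γ R} {s t : Set Γ} (hs : s.IsPWO) (ht : t.IsPWO) (hx : x.support ⊆ s)
    (hy : y.support ⊆ t) (a : Γ) :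
    (x * y).coeff a = ∑ ij ∈ Finset.antidiagonal hs ht a, x.coeff ij.1 * y.coeff ij.2 := by
  rw [HahnSeries.coeff_mul_left' hs hx]
  refine Finset.sum_subset (Finset.antidiagonal_mono_right hy) fun ij h1 h2 => ?_
  rw [Finset.mem_antidiagonal] at h1 h2
  have : y.coeff ij.2 = 0 := by
    by_contra h
    exact h2 ⟨h1.1, h, h1.2.2⟩
  rw [this, mul_zero]

/-- The monic polynomial whose coefficients are assembled from a family of polynomials. -/
theorem exists_monic_of_coeffs {P : AddSubmonoid Γ} (hw : (P : Set Γ).IsPWO) {g : K[X]}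
    (hg : g.Monic) {G : Γ → K[X]} (hG0 : G 0 = g) (hG : ∀ p ≠ 0, (G p).degree < g.degree) :
    ∃ f : (HahnSeries Γ K)[X], f.Monic ∧ f.natDegree = g.natDegree ∧
      ∀ i, f.coeff i = seriesOn P hw fun p => (G p).coeff i := by
  classical
  set c : ℕ → HahnSeries Γ K := fun i => seriesOn P hw fun p => (G p).coeff i with hc
  -- Only `G 0 = g` reaches degree `g.natDegree`, so the leading coefficient is the constant series
  -- 1.
  have hcn : c g.natDegree = 1 := by
    ext p
    by_cases hp : p ∈ P
    · rw [hc, seriesOn_coeff hw _ hp, HahnSeries.coeff_one]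
      split_ifs with h0
      · rw [h0, hG0]; exact hg
      · exact coeff_eq_zero_of_degree_lt ((hG p h0).trans_le degree_le_natDegree)
    · rw [hc, seriesOn_coeff_of_notMem hw _ hp, HahnSeries.coeff_one, if_neg]
      rintro rfl
      exact hp P.zero_mem
  have hcz : ∀ i, g.natDegree < i → c i = 0 := by
    intro i hi
    ext p
    by_cases hp : p ∈ P
    · rw [hc, seriesOn_coeff hw _ hp]
      refine coeff_eq_zero_of_natDegree_lt (lt_of_le_of_lt ?_ hi)
      by_cases h0 : p = 0
      · rw [h0, hG0]
      · exact natDegree_le_natDegree (hG p h0).le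
    · exact seriesOn_coeff_of_notMem hw _ hp
  set f : (HahnSeries Γ K)[X] := ∑ i ∈ Finset.range (g.natDegree + 1), monomial i (c i) with hf
  have hfc : ∀ i, f.coeff i = c i := by
    intro i
    rw [hf, finsetSum_coeff]
    simp only [coeff_monomial, Finset.sum_ite_eq', Finset.mem_range]
    split_ifs with h
    · rfl
    · exact (hcz i (by omega)).symm
  have hle : f.natDegree ≤ g.natDegree :=
    natDegree_le_iff_coeff_eq_zero.mpr fun i hi => (hfc i).trans (hcz i hi)
  have hmon : f.Monic := monic_of_natDegree_le_of_coeff_eq_one _ hle ((hfc _).trans hcn)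
  refine ⟨f, hmon, le_antisymm hle (le_natDegree_of_ne_zero ?_), hfc⟩
  rw [hfc, hcn]
  exact one_ne_zero

/-- Hensel's lemma for series with exponents in a well-ordered monoid `P`: a coprime
factorization of the constant term of a monic polynomial lifts. -/
theorem exists_monic_factor {P : AddSubmonoid Γ} (hP : ∀ p ∈ P, 0 ≤ p)
    (hw : (P : Set Γ).IsPWO) {f : (HahnSeries Γ K)[X]} (hf : f.Monic)
    (hfP : ∀ i, (f.coeff i).support ⊆ P) {g h : K[X]} (hg : g.Monic) (hh : h.Monic)
    (hgh : IsCoprime g h) (hdeg : f.natDegree = (g * h).natDegree)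
    (h0 : ∀ i, (f.coeff i).coeff 0 = (g * h).coeff i) :
    ∃ G H : (HahnSeries Γ K)[X], G.Monic ∧ G.natDegree = g.natDegree ∧
      (∀ i, (G.coeff i).support ⊆ P) ∧ G * H = f := by
  classical
  -- `f` is reread as a series with coefficients in `K[X]`. Its leading coefficient 1 has no term
  -- `x^p` with `p ≠ 0`, which gives the degree drop required of `F p`.
  set F : Γ → K[X] := fun p =>
    ∑ i ∈ Finset.range (f.natDegree + 1), monomial i ((f.coeff i).coeff p) with hF
  have hFc : ∀ p i, (F p).coeff i = (f.coeff i).coeff p := by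
    intro p i
    rw [hF, finsetSum_coeff]
    simp only [coeff_monomial, Finset.sum_ite_eq', Finset.mem_range]
    split_ifs with h
    · rfl
    · rw [coeff_eq_zero_of_natDegree_lt (by omega), HahnSeries.coeff_zero]
  have hmon : (g * h).Monic := hg.mul hh
  obtain ⟨G, H, hG0, hH0, hG, hH, hGH⟩ := exists_factor_coeffs hP hw hg hgh F
    (by ext i; rw [hFc, h0]) (by
      intro p hp
      rw [degree_eq_natDegree hmon.ne_zero, degree_lt_iff_coeff_zero]
      intro i hi
      rw [hFc]
      rcases hi.eq_or_lt with rfl | hi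
      · rw [← hdeg, show f.coeff f.natDegree = 1 from hf, HahnSeries.coeff_one, if_neg hp]
      · rw [coeff_eq_zero_of_natDegree_lt (by omega), HahnSeries.coeff_zero])
  obtain ⟨g', hg'm, hg'd, hg'c⟩ := exists_monic_of_coeffs hw hg hG0 hG
  obtain ⟨h', -, -, hh'c⟩ := exists_monic_of_coeffs hw hh hH0 hH
  refine ⟨g', h', hg'm, hg'd, fun i => hg'c i ▸ support_seriesOn_subset _ hw _, ?_⟩
  ext j p
  rw [← hFc, coeff_mul, HahnSeries.coeff_sum]
  have : ∀ x ∈ Finset.HasAntidiagonal.antidiagonal j, (g'.coeff x.1 * h'.coeff x.2).coeff p =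
      ∑ q ∈ Finset.antidiagonal hw hw p, (G q.1).coeff x.1 * (H q.2).coeff x.2 := by
    intro x _
    rw [hg'c, hh'c, coeff_mul_of_support_subset hw hw (support_seriesOn_subset _ hw _)
      (support_seriesOn_subset _ hw _)]
    refine Finset.sum_congr rfl fun q hq => ?_
    obtain ⟨h1, h2, -⟩ := Finset.mem_antidiagonal.mp hq
    rw [seriesOn_coeff hw _ h1, seriesOn_coeff hw _ h2]
  rw [Finset.sum_congr rfl this, Finset.sum_comm]
  simp only [← coeff_mul, ← finsetSum_coeff]
  by_cases hp : p ∈ P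
  · rw [hGH p hp]
  · have hempty : Finset.antidiagonal hw hw p = ∅ := by
      refine Finset.eq_empty_of_forall_notMem fun x hx => hp ?_
      obtain ⟨h1, h2, rfl⟩ := Finset.mem_antidiagonal.mp hx
      exact P.add_mem h1 h2
    rw [hempty, Finset.sum_empty, coeff_zero, hFc]
    by_contra hne
    exact hp (hfP j (Ne.symm hne))

end Hensel

/-! ### Admissible monoids of exponents and supports of inverses -/

theorem dot_nsmul {N : ℕ} (ω : Fin N → ℝ) (m : ℕ) (α : Fin N → ℚ) :
    dot ω (m • α) = m * dot ω α := by
  simp only [dot, Pi.smul_apply, nsmul_eq_mul, Finset.mul_sum]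
  refine Finset.sum_congr rfl fun i _ => ?_
  push_cast
  ring

theorem dot_eq_sum_of_toReal_eq {N : ℕ} (ω : Fin N → ℝ) {α : Fin N → ℚ}
    {s : Finset (Fin N → ℚ)} {a : (Fin N → ℚ) → {c : ℝ // 0 ≤ c}}
    (h : ∑ v ∈ s, a v • toReal v = toReal α) : dot ω α = ∑ v ∈ s, (a v : ℝ) * dot ω v := by
  have hcoord : ∀ j, (α j : ℝ) = ∑ v ∈ s, (a v : ℝ) * (v j : ℝ) := by
    intro j
    have := congrFun h j
    rw [Finset.sum_apply] at this
    exact this.symm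
  simp only [dot, hcoord, Finset.mul_sum]
  rw [Finset.sum_comm]
  exact Finset.sum_congr rfl fun v _ => Finset.sum_congr rfl fun j _ => by ring

/-- An admissible set of exponents in the half space `ω · α ≥ 0` lies in an `ω`-positive rational
cone, without translation. -/
theorem Admissible.exists_cone {N : ℕ} {ω : Fin N → ℝ} (hω : LinearIndependent ℚ ω)
    {E : Set (Fin N → ℚ)} (hE : Admissible ω E) (h0 : ∀ α ∈ E, 0 ≤ dot ω α) :
    ∃ t : Finset (Fin N → ℚ), (∀ v ∈ t, 0 ≤ dot ω v) ∧
      ∀ α ∈ E, toReal α ∈ PointedCone.hull ℝ (toReal '' (t : Set (Fin N → ℚ))) := by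
  classical
  obtain ⟨-, γ, σ, ⟨s, rfl⟩, h2, h3⟩ := id hE
  have hs : ∀ v ∈ s, 0 ≤ dot ω v := fun v hv => h2 _ (Submodule.subset_span ⟨v, hv, rfl⟩)
  -- This `m` puts every `m • v - γ`, for a generator `v` of positive weight, into the half space.
  obtain ⟨m, hm⟩ : ∃ m : ℕ, ∀ v ∈ s, 0 < dot ω v → dot ω γ ≤ m * dot ω v := by
    have : ∀ v : Fin N → ℚ, ∃ m : ℕ, 0 < dot ω v → dot ω γ ≤ m * dot ω v := by
      intro v
      obtain ⟨m, hm⟩ := exists_nat_ge (dot ω γ / dot ω v)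
      exact ⟨m, fun hv => (div_le_iff₀ hv).mp hm⟩
    choose m hm using this
    refine ⟨∑ v ∈ s, m v, fun v hv hpos => (hm v hpos).trans ?_⟩
    refine mul_le_mul_of_nonneg_right ?_ hpos.le
    exact_mod_cast Finset.single_le_sum (f := m) (fun _ _ => Nat.zero_le _) hv
  have hfin := hE.finite_le hω (m * ∑ v ∈ s, dot ω v - dot ω γ)
  -- Write `α + γ = ∑ a v • v`. If some `v` of positive weight has `a v ≥ m`, then `α` is `m • v -
  -- γ` plus a non-negative combination of `s`. Otherwise `dot ω α` is at most the constant in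
  -- `hfin`, and the finitely many such `α` are themselves taken as generators.
  refine ⟨s ∪ (s.filter fun v => 0 < dot ω v).image (fun v => m • v - γ) ∪ hfin.toFinset,
    ?_, ?_⟩
  · intro v hv
    simp only [Finset.mem_union, Finset.mem_image, Finset.mem_filter, Set.Finite.mem_toFinset] at hv
    rcases hv with (hv | ⟨w, ⟨hw, hpos⟩, rfl⟩) | hv
    · exact hs v hv
    · rw [sub_eq_add_neg, dot_add, dot_neg, dot_nsmul]
      linarith [hm w hw hpos]
    · exact h0 v hv.1
  · intro α hα
    obtain ⟨a, ha⟩ := (Submodule.mem_span_image_finset_iff_exists_fun' _).mp (h3 α hα)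
    by_cases hlarge : ∃ v ∈ s, 0 < dot ω v ∧ (m : ℝ) ≤ a v
    · obtain ⟨v, hv, hpos, hav⟩ := hlarge
      have hsplit : toReal α = toReal (m • v - γ) + ((⟨a v - m, sub_nonneg.mpr hav⟩ :
          {c : ℝ // 0 ≤ c}) • toReal v + ∑ w ∈ s.erase v, a w • toReal w) := by
        have h1 := Finset.add_sum_erase s (fun w => a w • toReal w) hv
        have h1' : a v • toReal v + ∑ w ∈ s.erase v, a w • toReal w = toReal (α + γ) := h1.trans ha
        funext j
        have h2 := congrFun h1' j
        simp only [Pi.add_apply] at h2 ⊢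
        change (a v : ℝ) * toReal v j + _ = _ at h2
        change _ = _ + (((a v : ℝ) - m) * toReal v j + _)
        simp only [toReal, Pi.add_apply, Pi.sub_apply, nsmul_eq_mul, Pi.mul_apply, Pi.natCast_apply] at h2 ⊢
        push_cast at h2 ⊢
        linarith
      rw [hsplit]
      refine Submodule.add_mem _ (Submodule.subset_span ⟨_, ?_, rfl⟩) (Submodule.add_mem _
        (Submodule.smul_mem _ _ (Submodule.subset_span ⟨_, ?_, rfl⟩))
        (Submodule.sum_mem _ fun w hw =>
          Submodule.smul_mem _ _ (Submodule.subset_span ⟨_, ?_, rfl⟩)))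
      · simp only [Finset.coe_union, Set.mem_union, Finset.mem_coe, Finset.mem_image,
          Finset.mem_filter]
        exact Or.inl (Or.inr ⟨v, ⟨hv, hpos⟩, rfl⟩)
      · simp [hv]
      · simp [Finset.mem_of_mem_erase hw]
    · push Not at hlarge
      refine Submodule.subset_span ⟨α, ?_, rfl⟩
      simp only [Finset.coe_union, Set.mem_union, Set.Finite.coe_toFinset]
      refine Or.inr ⟨hα, ?_⟩
      have hd := dot_eq_sum_of_toReal_eq ω ha
      rw [dot_add] at hd
      have : ∑ v ∈ s, (a v : ℝ) * dot ω v ≤ m * ∑ v ∈ s, dot ω v := by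
        rw [Finset.mul_sum]
        refine Finset.sum_le_sum fun v hv => ?_
        rcases (hs v hv).eq_or_lt with h | h
        · rw [← h]; simp
        · exact mul_le_mul_of_nonneg_right (hlarge v hv h).le h.le
      linarith

theorem Expo.zero_le_iff {N : ℕ} {ω : Fin N → ℝ} (hω : LinearIndependent ℚ ω) (α : Expo ω) :
    0 ≤ α ↔ 0 ≤ dot ω α := by
  rw [Expo.le_iff_dot_le hω]
  change dot ω 0 ≤ _ ↔ _
  rw [dot_zero]

/-- An admissible set of non-negative exponents lies in an admissible monoid of non-negative
exponents. -/
theorem Admissible.exists_addSubmonoid {N : ℕ} {ω : Fin N → ℝ} (hω : LinearIndependent ℚ ω)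
    {E : Set (Expo ω)} (hE : Admissible ω E) (h0 : ∀ α ∈ E, 0 ≤ α) :
    ∃ P : AddSubmonoid (Expo ω), Admissible ω (P : Set (Expo ω)) ∧ E ⊆ P ∧ ∀ p ∈ P, 0 ≤ p := by
  obtain ⟨t, ht, hEt⟩ := hE.exists_cone hω fun α hα => (Expo.zero_le_iff hω α).mp (h0 α hα)
  obtain ⟨k, hk, hlat⟩ := hE.1
  -- The lattice points of the untranslated cone: closed under addition because no shift `γ` is
  -- left.
  let P : AddSubmonoid (Fin N → ℚ) :=
    { carrier := {α | (∀ i, ∃ m : ℤ, α i = (m : ℚ) / (k : ℚ)) ∧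
        toReal α ∈ PointedCone.hull ℝ (toReal '' (t : Set (Fin N → ℚ)))}
      zero_mem' := ⟨fun i => ⟨0, by simp⟩, by
        have : toReal (0 : Fin N → ℚ) = 0 := by funext i; simp [toReal]
        rw [this]
        exact Submodule.zero_mem _⟩
      add_mem' := by
        rintro α β ⟨h1, h2⟩ ⟨h3, h4⟩
        refine ⟨fun i => ?_, ?_⟩
        · obtain ⟨m, hm⟩ := h1 i
          obtain ⟨n, hn⟩ := h3 i
          exact ⟨m + n, by rw [Pi.add_apply, hm, hn]; push_cast; ring⟩
        · rw [toReal_add]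
          exact Submodule.add_mem _ h2 h4 }
  refine ⟨P, ⟨⟨k, hk, fun α hα => hα.1⟩, 0, _, isRationalCone_hull t, isPositiveCone_hull ht,
    fun α hα => ?_⟩, fun α hα => ⟨hlat α hα, hEt α hα⟩, fun α hα => ?_⟩
  · rw [add_zero]
    exact hα.2
  · exact (Expo.zero_le_iff hω α).mpr (isPositiveCone_hull ht _ hα.2)

/-- For rationally independent `ω`, the exponents are totally ordered. -/
noncomputable abbrev Expo.linearOrder {N : ℕ} {ω : Fin N → ℝ} (hω : LinearIndependent ℚ ω) :
    LinearOrder (Expo ω) where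
  __ := (inferInstance : PartialOrder (Expo ω))
  le_total α β := by
    simp only [Expo.le_iff_dot_le hω]
    exact le_total _ _
  toDecidableLE := Classical.decRel _

/-- Take the least exponent `p` of `a⁻¹` outside `P`. In the coefficient of `a * a⁻¹` at `p`, a term
with exponents `q + r = p` and `q ≠ 0` has `r < p`, so `r ∈ P` and then `p ∈ P`, which is excluded.
Only `a.coeff 0 * a⁻¹.coeff p ≠ 0` survives, although 1 has no term at `p`. -/
theorem support_inv_subset {Γ K : Type*} [AddCommGroup Γ] [LinearOrder Γ] [IsOrderedAddMonoid Γ]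
    [Field K] {P : AddSubmonoid Γ} (hP : ∀ p ∈ P, 0 ≤ p) {a : HahnSeries Γ K}
    (ha : a.support ⊆ P) (h0 : a.coeff 0 ≠ 0) : a⁻¹.support ⊆ P := by
  by_contra hcon
  obtain ⟨p₀, hp₀, hp₀P⟩ := Set.not_subset.mp hcon
  have hwf : (a⁻¹.support \ P).IsWF := a⁻¹.isWF_support.mono Set.sdiff_subset
  have hne : (a⁻¹.support \ (P : Set Γ)).Nonempty := ⟨p₀, hp₀, hp₀P⟩
  set p := hwf.min hne
  obtain ⟨hp, hpP⟩ : p ∈ a⁻¹.support \ (P : Set Γ) := hwf.min_mem hne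
  have ha0 : a ≠ 0 := by
    rintro rfl
    exact h0 rfl
  have h1 : (a * a⁻¹).coeff p = a.coeff 0 * a⁻¹.coeff p := by
    rw [HahnSeries.coeff_mul, Finset.sum_eq_single (0, p)]
    · rintro ⟨q, r⟩ hqr hne'
      obtain ⟨hq, hr, hsum⟩ := Finset.mem_antidiagonal.mp hqr
      simp only at hq hr hsum
      exfalso
      have hq0 : q ≠ 0 := by
        rintro rfl
        rw [zero_add] at hsum
        exact hne' (by rw [hsum])
      have hqpos : 0 < q := lt_of_le_of_ne (hP q (ha hq)) hq0.symm
      have hrP : r ∈ P := by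
        by_contra hrP
        exact hwf.not_lt_min hne ⟨hr, hrP⟩ (by
          change r < p
          rw [← hsum]
          exact lt_add_of_pos_left r hqpos)
      exact hpP (hsum ▸ P.add_mem (ha hq) hrP)
    · intro hn
      exact absurd (Finset.mem_antidiagonal.mpr ⟨h0, hp, zero_add p⟩) hn
  rw [mul_inv_cancel₀ ha0, HahnSeries.coeff_one, if_neg] at h1
  · exact mul_ne_zero h0 hp h1.symm
  · intro h
    exact hpP (h ▸ P.zero_mem)

/-! ### The series form a field -/

section Field

variable {N : ℕ} {ω : Fin N → ℝ} {K : Type*} [Field K]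

theorem coeff_monomialSeries_mul (α β : Expo ω) (c : K) (a : S ω K) :
    ((monomialSeries ω α c * a : S ω K) : HahnSeries (Expo ω) K).coeff β =
      c * (a : HahnSeries (Expo ω) K).coeff (β - α) := by
  have := HahnSeries.coeff_single_mul_add (r := c) (x := (a : HahnSeries (Expo ω) K))
    (a := β - α) (b := α)
  rwa [sub_add_cancel] at this

theorem monomialSeries_mul_monomialSeries (α β : Expo ω) (c d : K) :
    monomialSeries ω α c * monomialSeries ω β d = monomialSeries ω (α + β) (c * d) :=
  Subtype.ext HahnSeries.single_mul_single

theorem monomialSeries_zero_one : monomialSeries ω (0 : Expo ω) (1 : K) = 1 := rfl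

theorem isDomain_S (hω : LinearIndependent ℚ ω) : IsDomain (S ω K) := by
  let _ := Expo.linearOrder hω
  have : IsDomain (HahnSeries (Expo ω) K) := inferInstance
  exact Subring.instIsDomainSubtypeMem _

theorem order_le_of_coeff_ne_zero (hω : LinearIndependent ℚ ω) {a : HahnSeries (Expo ω) K}
    {α : Expo ω} (h : a.coeff α ≠ 0) : a.order ≤ α := by
  let _ := Expo.linearOrder hω
  exact HahnSeries.order_le_of_coeff_ne_zero h

/-- Dividing by the leading monomial leaves a series with non-negative exponents and nonzero
constant term. Its support lies in an admissible monoid, and so does that of its inverse as a Hahn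
series. -/
theorem isField_S (hω : LinearIndependent ℚ ω) : IsField (S ω K) := by
  let _ := Expo.linearOrder hω
  have := isDomain_S (K := K) hω
  refine ⟨⟨0, 1, zero_ne_one⟩, mul_comm, fun {a} ha => ?_⟩
  have ha0 : (a : HahnSeries (Expo ω) K) ≠ 0 := fun h => ha (Subtype.ext h)
  set α := (a : HahnSeries (Expo ω) K).order
  set b : S ω K := monomialSeries ω (-α) 1 * a with hb
  have hbc : ∀ β, (b : HahnSeries (Expo ω) K).coeff β =
      (a : HahnSeries (Expo ω) K).coeff (β + α) := by
    intro β
    rw [hb, coeff_monomialSeries_mul, one_mul, sub_neg_eq_add]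
  have hb0 : (b : HahnSeries (Expo ω) K).coeff 0 ≠ 0 := by
    rw [hbc, zero_add]
    exact fun h => ha0 (HahnSeries.coeff_order_eq_zero.mp h)
  have hbpos : ∀ β ∈ (b : HahnSeries (Expo ω) K).support, 0 ≤ β := by
    intro β hβ
    have h1 : (a : HahnSeries (Expo ω) K).coeff (β + α) ≠ 0 := by rw [← hbc]; exact hβ
    have h2 := order_le_of_coeff_ne_zero hω h1
    exact le_add_iff_nonneg_left _ |>.mp h2
  obtain ⟨P, hPadm, hbP, hP⟩ := Admissible.exists_addSubmonoid hω b.2 hbpos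
  have hinv := support_inv_subset hP hbP hb0
  have hbne : (b : HahnSeries (Expo ω) K) ≠ 0 := by
    intro h
    rw [h] at hb0
    exact hb0 rfl
  obtain ⟨c, hc⟩ : ∃ c : S ω K, b * c = 1 :=
    ⟨⟨(b : HahnSeries (Expo ω) K)⁻¹, hPadm.mono hinv⟩, Subtype.ext (mul_inv_cancel₀ hbne)⟩
  refine ⟨c * monomialSeries ω (-α) 1, ?_⟩
  rw [← hc, hb]
  ring

end Field

/-! ### Newton–Puiseux theorem and Nullstellensatz -/

section AlgClosed

open Polynomial

/-- Split off the full power of `X - a` at a root `a`. If nothing else remains, `f = (X - a) ^ n`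
has subleading coefficient `-n a`; in characteristic zero its vanishing forces `a = 0` and `f = X ^
n`. -/
theorem exists_coprime_factor {K : Type*} [Field K] [IsAlgClosed K] [CharZero K] {f : K[X]}
    (hf : f.Monic) (hn : 0 < f.natDegree) (h1 : f.coeff (f.natDegree - 1) = 0)
    (h2 : f ≠ X ^ f.natDegree) :
    ∃ g h : K[X], g.Monic ∧ h.Monic ∧ IsCoprime g h ∧ f = g * h ∧ 0 < g.natDegree ∧
      g.natDegree < f.natDegree := by
  obtain ⟨a, ha⟩ := IsAlgClosed.exists_root f (natDegree_pos_iff_degree_pos.mp hn).ne'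
  obtain ⟨q, hq, hdvd⟩ := exists_eq_pow_rootMultiplicity_mul_and_not_dvd f hf.ne_zero a
  have hm := (rootMultiplicity_pos hf.ne_zero).mpr ha
  set m := f.rootMultiplicity a
  have hgm : ((X - C a) ^ m).Monic := (monic_X_sub_C a).pow m
  have hqm : q.Monic := hgm.of_mul_monic_left (hq ▸ hf)
  have hgd : ((X - C a) ^ m).natDegree = m := by
    rw [natDegree_pow, natDegree_X_sub_C, mul_one]
  have hdeg : f.natDegree = m + q.natDegree := by
    conv_lhs => rw [hq, hgm.natDegree_mul hqm, hgd]
  refine ⟨_, q, hgm, hqm, IsCoprime.pow_left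
    (((irreducible_X_sub_C a).coprime_iff_not_dvd).mpr hdvd), hq, by omega, ?_⟩
  rw [hgd, hdeg]
  by_contra! hle
  have hq1 : q = 1 := hqm.natDegree_eq_zero.mp (by omega)
  have hfm : f = (X - C a) ^ f.natDegree := by
    have : f.natDegree = m := by omega
    rw [this]
    conv_lhs => rw [hq, hq1, mul_one]
  have hnext : f.nextCoeff = f.natDegree • -a := by
    conv_lhs => rw [hfm, (monic_X_sub_C a).nextCoeff_pow, nextCoeff_X_sub_C]
  rw [nextCoeff_of_natDegree_pos hn, h1, eq_comm, nsmul_eq_mul] at hnext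
  have ha0 : a = 0 := by
    rcases mul_eq_zero.mp hnext with h | h
    · exact absurd (Nat.cast_eq_zero.mp h) hn.ne'
    · exact neg_eq_zero.mp h
  rw [ha0, C_0, sub_zero] at hfm
  exact h2 hfm

/-- Used to choose the shift `c` that kills the subleading coefficient. The coefficient is the value
at `c` of a Hasse derivative of degree at most 1. -/
theorem coeff_taylor_natDegree_sub_one {R : Type*} [CommRing R] {p : R[X]} (hp : p.Monic)
    (hn : 0 < p.natDegree) (c : R) :
    (taylor c p).coeff (p.natDegree - 1) = p.coeff (p.natDegree - 1) + p.natDegree * c := by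
  have h1 : (hasseDeriv (p.natDegree - 1) p).natDegree < 2 :=
    (natDegree_hasseDeriv_le p _).trans_lt (by omega)
  rw [taylor_coeff, eval_eq_sum_range' h1, Finset.sum_range_succ, Finset.sum_range_one,
    hasseDeriv_coeff, hasseDeriv_coeff]
  have h2 : 1 + (p.natDegree - 1) = p.natDegree := by omega
  have h3 : p.natDegree.choose (p.natDegree - 1) = p.natDegree := by
    rw [Nat.choose_symm (by omega : 1 ≤ p.natDegree), Nat.choose_one_right]
  rw [h2, h3, hp.coeff_natDegree]
  simp

theorem Admissible.biUnion {N : ℕ} {ω : Fin N → ℝ} {ι : Type*} (s : Finset ι)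
    {E : ι → Set (Fin N → ℚ)} (h : ∀ i ∈ s, Admissible ω (E i)) :
    Admissible ω (⋃ i ∈ s, E i) := by
  classical
  induction s using Finset.induction_on with
  | empty => exact (admissible_singleton ω 0).mono (by simp)
  | insert a s _ ih =>
    rw [Finset.set_biUnion_insert]
    exact (h a (Finset.mem_insert_self _ _)).union
      (ih fun i hi => h i (Finset.mem_insert_of_mem hi))

variable {N : ℕ} {ω : Fin N → ℝ} {K : Type*} [Field K]

theorem Expo.exists_nsmul_eq {n : ℕ} (hn : n ≠ 0) (α : Expo ω) : ∃ β : Expo ω, n • β = α := by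
  obtain ⟨β, hβ⟩ : ∃ β : Fin N → ℚ, n • β = α :=
    ⟨fun i => (α : Fin N → ℚ) i / n, by
      funext i
      have : (n : ℚ) ≠ 0 := by exact_mod_cast hn
      simp only [Pi.smul_apply, nsmul_eq_mul]
      field_simp⟩
  exact ⟨β, hβ⟩

theorem monomialSeries_pow (α : Expo ω) (c : K) (n : ℕ) :
    monomialSeries ω α c ^ n = monomialSeries ω (n • α) (c ^ n) :=
  Subtype.ext (HahnSeries.single_pow α n c)

theorem coeff_mul_monomialSeries_neg_pow (a : S ω K) (α β : Expo ω) (n : ℕ) :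
    ((a * monomialSeries ω (-α) 1 ^ n : S ω K) : HahnSeries (Expo ω) K).coeff β =
      (a : HahnSeries (Expo ω) K).coeff (β + n • α) := by
  rw [mul_comm, monomialSeries_pow, coeff_monomialSeries_mul, one_pow, one_mul, smul_neg,
    sub_neg_eq_add]

theorem coeff_order_ne_zero {a : S ω K} (ha : a ≠ 0) :
    (a : HahnSeries (Expo ω) K).coeff (a : HahnSeries (Expo ω) K).order ≠ 0 :=
  fun h => ha (Subtype.ext (HahnSeries.coeff_order_eq_zero.mp h))

/-- Scaling the roots makes all exponents of the coefficients non-negative, with the exponent zero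
occurring below the leading coefficient. -/
theorem exists_scaleRoots (hω : LinearIndependent ℚ ω) {q : (S ω K)[X]} (hq : q.Monic)
    (hne : q ≠ X ^ q.natDegree) :
    ∃ α : Expo ω,
      (∀ i, ∀ β ∈ ((q.scaleRoots (monomialSeries ω (-α) 1)).coeff i :
        HahnSeries (Expo ω) K).support, 0 ≤ β) ∧
      ∃ i < q.natDegree, ((q.scaleRoots (monomialSeries ω (-α) 1)).coeff i :
        HahnSeries (Expo ω) K).coeff 0 ≠ 0 := by
  classical
  let _ := Expo.linearOrder hω
  -- `β i` is the order of the `i`-th coefficient divided by `q.natDegree - i`. Scaling by `x^(-α)`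
  -- lowers that order by `(q.natDegree - i) • α`, so the least `β i` over nonzero coefficients is
  -- the right `α`: the slope of an edge of the Newton polygon.
  have hdiv : ∀ i : ℕ, ∃ β : Expo ω, i < q.natDegree →
      (q.natDegree - i) • β = (q.coeff i : HahnSeries (Expo ω) K).order := by
    intro i
    by_cases hi : i < q.natDegree
    · obtain ⟨β, hβ⟩ := Expo.exists_nsmul_eq (n := q.natDegree - i) (by omega)
        (q.coeff i : HahnSeries (Expo ω) K).order
      exact ⟨β, fun _ => hβ⟩
    · exact ⟨0, fun h => absurd h hi⟩
  choose β hβ using hdiv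
  have hex : ((Finset.range q.natDegree).filter fun i => q.coeff i ≠ 0).Nonempty := by
    by_contra hemp
    rw [Finset.not_nonempty_iff_eq_empty, Finset.filter_eq_empty_iff] at hemp
    refine hne ?_
    ext1 i
    rw [coeff_X_pow]
    rcases lt_trichotomy i q.natDegree with h | h | h
    · rw [if_neg h.ne]
      exact not_not.mp (hemp (Finset.mem_range.mpr h))
    · rw [if_pos h, h, hq.coeff_natDegree]
    · rw [if_neg h.ne', coeff_eq_zero_of_natDegree_lt h]
  obtain ⟨i₀, hi₀, hmin⟩ := Finset.exists_min_image _ β hex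
  rw [Finset.mem_filter, Finset.mem_range] at hi₀
  refine ⟨β i₀, fun i γ hγ => ?_, i₀, hi₀.1, ?_⟩
  · rw [HahnSeries.mem_support, coeff_scaleRoots, coeff_mul_monomialSeries_neg_pow] at hγ
    rcases lt_trichotomy i q.natDegree with h | h | h
    · have hqi : q.coeff i ≠ 0 := by
        intro h0
        rw [h0] at hγ
        exact hγ rfl
      have h1 := order_le_of_coeff_ne_zero hω hγ
      rw [← hβ i h] at h1
      have h2 : (q.natDegree - i) • β i₀ ≤ (q.natDegree - i) • β i :=
        nsmul_le_nsmul_right (hmin i (Finset.mem_filter.mpr ⟨Finset.mem_range.mpr h, hqi⟩)) _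
      exact le_add_iff_nonneg_left _ |>.mp (h2.trans h1)
    · rw [h, hq.coeff_natDegree, Nat.sub_self, zero_nsmul, add_zero] at hγ
      change (1 : HahnSeries (Expo ω) K).coeff γ ≠ 0 at hγ
      rw [HahnSeries.coeff_one] at hγ
      exact (of_not_not fun h => hγ (if_neg fun h' => h h'.ge))
    · rw [coeff_eq_zero_of_natDegree_lt h] at hγ
      exact absurd rfl hγ
  · rw [coeff_scaleRoots, coeff_mul_monomialSeries_neg_pow, zero_add, hβ i₀ hi₀.1]
    exact coeff_order_ne_zero hi₀.2

/-- A monic polynomial with coefficients of non-negative order whose residue splits into coprime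
factors has a monic factor over the series whose residue is the first one. -/
theorem exists_monic_factor_S (hω : LinearIndependent ℚ ω) {r : (S ω K)[X]} (hr : r.Monic)
    (hpos : ∀ i, ∀ β ∈ (r.coeff i : HahnSeries (Expo ω) K).support, 0 ≤ β) {g h : K[X]}
    (hg : g.Monic) (hh : h.Monic) (hgh : IsCoprime g h) (hdeg : r.natDegree = (g * h).natDegree)
    (h0 : ∀ i, (r.coeff i : HahnSeries (Expo ω) K).coeff 0 = (g * h).coeff i) :
    ∃ G : (S ω K)[X], G.Monic ∧ G.natDegree = g.natDegree ∧
      ∀ z, G.eval z = 0 → r.eval z = 0 := by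
  have hadm : Admissible ω (⋃ i ∈ Finset.range (r.natDegree + 1),
      (r.coeff i : HahnSeries (Expo ω) K).support) :=
    Admissible.biUnion _ fun i _ => (r.coeff i).2
  obtain ⟨P, hPadm, hsub, hP⟩ := Admissible.exists_addSubmonoid hω hadm (by
    intro β hβ
    obtain ⟨i, -, hi⟩ := Set.mem_iUnion₂.mp hβ
    exact hpos i β hi)
  have hinj : Function.Injective (puiseux ω K).subtype := Subtype.val_injective
  obtain ⟨G, H, hG, hGd, hGP, hGH⟩ := exists_monic_factor hP (Admissible.isPWO hω hPadm)
    (f := r.map (puiseux ω K).subtype) (hr.map _) (by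
      intro i β hβ
      rw [coeff_map] at hβ
      refine hsub (Set.mem_iUnion₂.mpr ⟨i, ?_, hβ⟩)
      by_contra hi
      rw [Finset.mem_range, not_lt, Nat.succ_le_iff] at hi
      rw [coeff_eq_zero_of_natDegree_lt hi] at hβ
      exact hβ rfl) hg hh hgh (by rw [natDegree_map_eq_of_injective hinj, hdeg]) (by
      intro i
      rw [coeff_map]
      exact h0 i)
  -- Only `G` has to descend to admissible series; the cofactor `H` serves merely to carry roots of
  -- `G` to roots of `r`, and this happens over Hahn series.
  have hGS : (↑G.coeffs : Set (HahnSeries (Expo ω) K)) ⊆ puiseux ω K := by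
    intro x hx
    obtain ⟨i, -, rfl⟩ := mem_coeffs_iff.mp hx
    exact hPadm.mono (hGP i)
  refine ⟨G.toSubring _ hGS, (monic_toSubring _ _ _).mpr hG, by rw [natDegree_toSubring, hGd],
    fun z hz => hinj ?_⟩
  have h1 : G.eval ((puiseux ω K).subtype z) = 0 := by
    rw [← map_toSubring G _ hGS, eval_map_apply, hz, map_zero]
  rw [map_zero, ← eval_map_apply, ← hGH, eval_mul, h1, zero_mul]

/-- Strong induction on the degree: shifting and scaling change roots reversibly, and Hensel's lemma
then yields a monic factor of smaller positive degree. -/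
theorem exists_root_of_monic [IsAlgClosed K] [CharZero K] (hω : LinearIndependent ℚ ω) (n : ℕ) :
    ∀ p : (S ω K)[X], p.Monic → p.natDegree = n → 0 < n → ∃ x, p.eval x = 0 := by
  induction n using Nat.strong_induction_on with
  | _ n ih =>
  intro p hp hpn hn
  have := isDomain_S (K := K) hω
  have hinv : (n : S ω K) * monomialSeries ω 0 (n : K)⁻¹ = 1 := by
    have h1 : (n : S ω K) = monomialSeries ω 0 (n : K) := rfl
    rw [h1, monomialSeries_mul_monomialSeries, add_zero,
      mul_inv_cancel₀ (Nat.cast_ne_zero.mpr hn.ne'), monomialSeries_zero_one]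
  set c : S ω K := -(monomialSeries ω 0 (n : K)⁻¹ * p.coeff (n - 1)) with hc
  set q := taylor c p with hq
  have hqm : q.Monic := by
    rw [Monic, hq, leadingCoeff_taylor]
    exact hp
  have hqn : q.natDegree = n := by rw [hq, natDegree_taylor, hpn]
  have hq1 : q.coeff (n - 1) = 0 := by
    have := coeff_taylor_natDegree_sub_one hp (hpn ▸ hn) c
    rw [hpn] at this
    rw [hq, this, hc]
    linear_combination -(p.coeff (n - 1)) * hinv
  suffices h : ∃ z, q.eval z = 0 by
    obtain ⟨z, hz⟩ := h
    exact ⟨z + c, by rw [← taylor_eval, ← hq, hz]⟩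
  by_cases hX : q = X ^ q.natDegree
  · refine ⟨0, ?_⟩
    rw [hX, hqn, eval_pow, eval_X, zero_pow hn.ne']
  obtain ⟨α, hpos, i, hi, hi0⟩ := exists_scaleRoots hω hqm hX
  set s : S ω K := monomialSeries ω (-α) 1
  have hs : s * monomialSeries ω α 1 = 1 := by
    rw [monomialSeries_mul_monomialSeries, neg_add_cancel, one_mul, monomialSeries_zero_one]
  set r := q.scaleRoots s with hr
  have hrm : r.Monic := (monic_scaleRoots_iff s).mpr hqm
  have hrn : r.natDegree = n := by rw [hr, natDegree_scaleRoots, hqn]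
  suffices h : ∃ z, r.eval z = 0 by
    obtain ⟨z, hz⟩ := h
    refine ⟨monomialSeries ω α 1 * z, ?_⟩
    have h1 : q = r.scaleRoots (monomialSeries ω α 1) := by
      rw [hr, ← scaleRoots_mul, hs, scaleRoots_one]
    rw [h1, scaleRoots_eval_mul, hz, mul_zero]
  -- The residue polynomial of constant terms. It inherits the zero subleading coefficient, and the
  -- index `i` with nonzero constant term prevents `f = X ^ n`.
  set f : K[X] := ∑ i ∈ Finset.range (n + 1),
    monomial i ((r.coeff i : HahnSeries (Expo ω) K).coeff 0) with hf
  have hfc : ∀ i, f.coeff i = (r.coeff i : HahnSeries (Expo ω) K).coeff 0 := by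
    intro i
    rw [hf, finsetSum_coeff]
    simp only [coeff_monomial, Finset.sum_ite_eq', Finset.mem_range]
    split_ifs with h
    · rfl
    · rw [coeff_eq_zero_of_natDegree_lt (by omega)]
      rfl
  have hfn : f.coeff n = 1 := by
    rw [hfc]
    have : r.coeff n = 1 := hrn ▸ hrm.coeff_natDegree
    rw [this]
    change (1 : HahnSeries (Expo ω) K).coeff 0 = 1
    rw [HahnSeries.coeff_one, if_pos rfl]
  have hfle : f.natDegree ≤ n := natDegree_le_iff_coeff_eq_zero.mpr fun j hj => by
    rw [hfc, coeff_eq_zero_of_natDegree_lt (by omega)]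
    rfl
  have hfm : f.Monic := monic_of_natDegree_le_of_coeff_eq_one n hfle hfn
  have hfd : f.natDegree = n :=
    le_antisymm hfle (le_natDegree_of_ne_zero (by rw [hfn]; exact one_ne_zero))
  have hf1 : f.coeff (f.natDegree - 1) = 0 := by
    rw [hfd, hfc, hr, coeff_scaleRoots, hq1, zero_mul]
    rfl
  have hfX : f ≠ X ^ f.natDegree := by
    intro h
    have h1 := hfc i
    rw [h, hfd, coeff_X_pow, if_neg (by omega)] at h1
    exact hi0 h1.symm
  obtain ⟨g, h, hgm, hhm, hgh, hfgh, hg0, hgn⟩ := exists_coprime_factor hfm (hfd ▸ hn) hf1 hfX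
  obtain ⟨G, hGm, hGd, hGr⟩ := exists_monic_factor_S hω hrm hpos hgm hhm hgh
    (by rw [hrn, ← hfgh, hfd]) (fun i => by rw [← hfgh, hfc])
  obtain ⟨z, hz⟩ := ih G.natDegree (by omega) G hGm rfl (by omega)
  exact ⟨z, hGr z hz⟩

/-- Hilbert's Nullstellensatz over the field of `ω`-positive Puiseux series. -/
theorem exists_pow_mem_of_eval_eq_zero [IsAlgClosed K] [CharZero K] (hω : LinearIndependent ℚ ω)
    {M : ℕ} (I : Ideal (MvPolynomial (Fin M) (S ω K))) {f : MvPolynomial (Fin M) (S ω K)}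
    (hf : ∀ ψ ∈ zeroes I, MvPolynomial.eval ψ f = 0) : ∃ n, f ^ n ∈ I := by
  let _ : Field (S ω K) := (isField_S hω).toField
  have : IsAlgClosed (S ω K) := IsAlgClosed.of_exists_root _ fun p hp hirr =>
    exists_root_of_monic hω p.natDegree p hp rfl hirr.natDegree_pos
  have h1 : f ∈ I.radical := by
    rw [← MvPolynomial.vanishingIdeal_zeroLocus_eq_radical (K := S ω K)]
    intro ψ hψ
    exact hf ψ hψ
  exact h1

end AlgClosed

/-! ### Homogeneous parts of series -/

section Part

variable {N M : ℕ} {ω : Fin N → ℝ} {K : Type*} [Field K]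

theorem le_ord_iff {ℓ : ℝ} {a : S ω K} :
    (ℓ : WithTop ℝ) ≤ ord a ↔
      ∀ α, (a : HahnSeries (Expo ω) K).coeff α ≠ 0 → ℓ ≤ dot ω α := by
  by_cases ha : a = 0
  · subst ha
    rw [ord_zero]
    exact iff_of_true le_top fun α h => absurd rfl h
  · obtain ⟨h1, h2⟩ := ord_isLeast a ha
    rw [h1, WithTop.coe_le_coe]
    refine ⟨fun h α hα => h.trans (h2.2 ⟨α, hα, rfl⟩), fun h => ?_⟩
    obtain ⟨α, hα, hα'⟩ := h2.1
    rw [← hα']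
    exact h α hα

theorem ord_eq_top_iff {a : S ω K} : ord a = ⊤ ↔ a = 0 := by
  refine ⟨fun h => ?_, fun h => h ▸ ord_zero⟩
  by_contra ha
  rw [(ord_isLeast a ha).1] at h
  exact WithTop.coe_ne_top h

/-- The part of a series consisting of the terms `c_α x^α` with `ω · α = ℓ`. -/
noncomputable def part (ℓ : ℝ) : S ω K →+ S ω K where
  toFun a :=
    have hsub : (Function.support fun α : Expo ω =>
        if dot ω α = ℓ then (a : HahnSeries (Expo ω) K).coeff α else 0) ⊆
        (a : HahnSeries (Expo ω) K).support := fun α hα h => hα (by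
      beta_reduce
      rw [h, ite_self])
    ⟨⟨fun α => if dot ω α = ℓ then (a : HahnSeries (Expo ω) K).coeff α else 0,
      (a : HahnSeries (Expo ω) K).isPWO_support.mono hsub⟩, a.2.mono hsub⟩
  map_zero' := Subtype.ext (HahnSeries.ext (funext fun _ => ite_self _))
  map_add' a b := by
    refine Subtype.ext (HahnSeries.ext (funext fun α => ?_))
    change (if dot ω α = ℓ then (a : HahnSeries (Expo ω) K).coeff α +
      (b : HahnSeries (Expo ω) K).coeff α else 0) = (if dot ω α = ℓ then _ else 0) +
      (if dot ω α = ℓ then _ else 0)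
    split_ifs
    · rfl
    · exact (add_zero _).symm

theorem part_coeff (ℓ : ℝ) (a : S ω K) (α : Expo ω) :
    (part ℓ a : HahnSeries (Expo ω) K).coeff α =
      if dot ω α = ℓ then (a : HahnSeries (Expo ω) K).coeff α else 0 := rfl

theorem part_eq_zero_of_lt {ℓ : ℝ} {a : S ω K} (h : (ℓ : WithTop ℝ) < ord a) : part ℓ a = 0 := by
  refine Subtype.ext (HahnSeries.ext (funext fun α => ?_))
  rw [part_coeff]
  split_ifs with hα
  · by_contra hne
    by_cases ha : a = 0
    · exact hne (by rw [ha])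
    · obtain ⟨h1, h2⟩ := ord_isLeast a ha
      rw [h1, WithTop.coe_lt_coe] at h
      exact absurd (h2.2 ⟨α, hne, rfl⟩) (not_le.mpr (hα ▸ h))
  · rfl

/-- By rational independence only one exponent has weight `ℓ`, so the part is a single term. -/
theorem part_eq_firstTerm (hω : LinearIndependent ℚ ω) {ℓ : ℝ} {a : S ω K}
    (h : ord a = ℓ) : part ℓ a = firstTerm a := by
  have ha : a ≠ 0 := fun h0 => WithTop.coe_ne_top (h.symm.trans (ord_eq_top_iff.mpr h0))
  rw [(ord_isLeast a ha).1, WithTop.coe_inj] at h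
  refine Subtype.ext (HahnSeries.ext (funext fun α => ?_))
  rw [part_coeff]
  change _ = (HahnSeries.single _ _ : HahnSeries (Expo ω) K).coeff α
  split_ifs with hα
  · have : α = (a : HahnSeries (Expo ω) K).order := dot_injective hω (hα.trans h.symm)
    rw [this, HahnSeries.coeff_single_same]
  · rw [HahnSeries.coeff_single_of_ne]
    rintro rfl
    exact hα h

theorem firstTerm_ne_zero {a : S ω K} (ha : a ≠ 0) : firstTerm a ≠ 0 := fun h =>
  coeff_order_ne_zero ha (HahnSeries.single_eq_zero_iff.mp (congrArg Subtype.val h))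

theorem firstTerm_zero : firstTerm (0 : S ω K) = 0 :=
  Subtype.ext (HahnSeries.single_eq_zero)

theorem ord_firstTerm (a : S ω K) : ord (firstTerm a) = ord a := by
  by_cases ha : a = 0
  · rw [ha, firstTerm_zero]
  · rw [(ord_isLeast a ha).1, (ord_isLeast _ (firstTerm_ne_zero ha)).1]
    have h : (firstTerm a : HahnSeries (Expo ω) K).order = (a : HahnSeries (Expo ω) K).order :=
      HahnSeries.order_single (Γ := Expo ω) (coeff_order_ne_zero ha)
    rw [h]

theorem ord_eq_of_part_ne_zero {ℓ : ℝ} {a : S ω K} (h : (ℓ : WithTop ℝ) ≤ ord a)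
    (hne : part ℓ a ≠ 0) : ord a = ℓ :=
  le_antisymm (not_lt.mp fun hlt => hne (part_eq_zero_of_lt hlt)) h

theorem exists_coeff_ne_zero_of_mul {a b : HahnSeries (Expo ω) K} {γ : Expo ω}
    (h : (a * b).coeff γ ≠ 0) : ∃ α β, a.coeff α ≠ 0 ∧ b.coeff β ≠ 0 ∧ α + β = γ := by
  obtain ⟨α, hα, β, hβ, hαβ⟩ := Set.mem_add.mp (HahnSeries.support_mul_subset (x := a) (y := b) h)
  exact ⟨α, β, hα, hβ, hαβ⟩

theorem dot_expo_add (α β : Expo ω) : dot ω (α + β) = dot ω α + dot ω β := dot_add ω α β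

theorem le_ord_mul {ℓ m : ℝ} {a b : S ω K} (ha : (ℓ : WithTop ℝ) ≤ ord a)
    (hb : (m : WithTop ℝ) ≤ ord b) : ((ℓ + m : ℝ) : WithTop ℝ) ≤ ord (a * b) := by
  rw [le_ord_iff] at *
  intro γ hγ
  obtain ⟨α, β, hα, hβ, rfl⟩ := exists_coeff_ne_zero_of_mul hγ
  rw [dot_expo_add]
  exact add_le_add (ha α hα) (hb β hβ)

theorem le_ord_sum {ι : Type*} {s : Finset ι} {ℓ : ℝ} {a : ι → S ω K}
    (ha : ∀ i ∈ s, (ℓ : WithTop ℝ) ≤ ord (a i)) : (ℓ : WithTop ℝ) ≤ ord (∑ i ∈ s, a i) := by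
  classical
  induction s using Finset.induction_on with
  | empty => rw [Finset.sum_empty, ord_zero]; exact le_top
  | insert i s hi ih =>
    rw [Finset.sum_insert hi]
    have h1 := le_ord_iff.mp (ha i (Finset.mem_insert_self _ _))
    have h2 := le_ord_iff.mp (ih fun j hj => ha j (Finset.mem_insert_of_mem hj))
    refine le_ord_iff.mpr fun α hα => ?_
    by_contra hlt
    refine hα ?_
    change (a i : HahnSeries (Expo ω) K).coeff α + ((∑ i ∈ s, a i : S ω K) :
      HahnSeries (Expo ω) K).coeff α = 0
    rw [not_not.mp fun h => hlt (h1 α h), not_not.mp fun h => hlt (h2 α h), add_zero]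

/-- Lower bounds on the orders suffice: if exponents of weight at least `ℓ` and `m` add up to weight
`ℓ + m`, both bounds are equalities. Working with a fixed level avoids any case distinction on
whether the order is attained. -/
theorem part_mul {ℓ m : ℝ} {a b : S ω K} (ha : (ℓ : WithTop ℝ) ≤ ord a)
    (hb : (m : WithTop ℝ) ≤ ord b) : part (ℓ + m) (a * b) = part ℓ a * part m b := by
  rw [le_ord_iff] at ha hb
  refine Subtype.ext (HahnSeries.ext (funext fun γ => ?_))
  have hsub : ∀ (k : ℝ) (c : S ω K), (part k c : HahnSeries (Expo ω) K).support ⊆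
      (c : HahnSeries (Expo ω) K).support := by
    intro k c α hα h
    rw [HahnSeries.mem_support, part_coeff, h, ite_self] at hα
    exact hα rfl
  rw [part_coeff, Subring.coe_mul, Subring.coe_mul, coeff_mul_of_support_subset
    (a : HahnSeries (Expo ω) K).isPWO_support (b : HahnSeries (Expo ω) K).isPWO_support
    (hsub _ _) (hsub _ _), HahnSeries.coeff_mul]
  split_ifs with hγ
  · refine Finset.sum_congr rfl fun x hx => ?_
    obtain ⟨h1, h2, h3⟩ := Finset.mem_antidiagonal.mp hx
    have h4 := ha _ h1
    have h5 := hb _ h2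
    rw [← h3, dot_expo_add] at hγ
    rw [part_coeff, part_coeff, if_pos (by linarith), if_pos (by linarith)]
  · refine (Finset.sum_eq_zero fun x hx => ?_).symm
    obtain ⟨-, -, h3⟩ := Finset.mem_antidiagonal.mp hx
    rw [← h3, dot_expo_add] at hγ
    rw [part_coeff, part_coeff]
    split_ifs with h1 h2
    · exact absurd (by rw [h1, h2]) hγ
    · exact mul_zero _
    · exact zero_mul _
    · exact zero_mul _

theorem part_zero_one : part 0 (1 : S ω K) = 1 := by
  refine Subtype.ext (HahnSeries.ext (funext fun α => ?_))
  rw [part_coeff, Subring.coe_one, HahnSeries.coeff_one]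
  split_ifs with h1 h2 h2
  · rfl
  · rfl
  · exact absurd (h2 ▸ dot_zero ω) h1
  · rfl

theorem zero_le_ord_one : ((0 : ℝ) : WithTop ℝ) ≤ ord (1 : S ω K) := by
  refine le_ord_iff.mpr fun α hα => ?_
  rw [Subring.coe_one, HahnSeries.coeff_one] at hα
  have : α = 0 := of_not_not fun h => hα (if_neg h)
  rw [this]
  exact (dot_zero ω).ge

theorem part_pow {ℓ : ℝ} {a : S ω K} (ha : (ℓ : WithTop ℝ) ≤ ord a) (n : ℕ) :
    ((n * ℓ : ℝ) : WithTop ℝ) ≤ ord (a ^ n) ∧ part (n * ℓ) (a ^ n) = part ℓ a ^ n := by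
  induction n with
  | zero => simpa using ⟨zero_le_ord_one, part_zero_one⟩
  | succ n ih =>
    have : ((n + 1 : ℕ) : ℝ) * ℓ = n * ℓ + ℓ := by push_cast; ring
    rw [this, pow_succ, pow_succ, ← ih.2]
    exact ⟨le_ord_mul ih.1 ha, part_mul ih.1 ha⟩

theorem part_prod {ι : Type*} (s : Finset ι) {ℓ : ι → ℝ} {a : ι → S ω K}
    (ha : ∀ i ∈ s, (ℓ i : WithTop ℝ) ≤ ord (a i)) :
    ((∑ i ∈ s, ℓ i : ℝ) : WithTop ℝ) ≤ ord (∏ i ∈ s, a i) ∧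
      part (∑ i ∈ s, ℓ i) (∏ i ∈ s, a i) = ∏ i ∈ s, part (ℓ i) (a i) := by
  classical
  induction s using Finset.induction_on with
  | empty =>
    simp only [Finset.sum_empty, Finset.prod_empty]
    exact ⟨zero_le_ord_one, part_zero_one⟩
  | insert i s hi ih =>
    have h1 := ha i (Finset.mem_insert_self _ _)
    have h2 := ih fun j hj => ha j (Finset.mem_insert_of_mem hj)
    rw [Finset.sum_insert hi, Finset.prod_insert hi, Finset.prod_insert hi, ← h2.2]
    exact ⟨le_ord_mul h1 h2.1, part_mul h1 h2.1⟩

end Part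

/-! ### Weighted orders and initial parts of polynomials -/

section InitialPart

variable {N M : ℕ} {ω : Fin N → ℝ} {K : Type*} [Field K] {η : Fin M → WithTop ℝ}

theorem weight_add (η : Fin M → WithTop ℝ) (β γ : Fin M →₀ ℕ) :
    weight η (β + γ) = weight η β + weight η γ := by
  simp [weight, add_nsmul, Finset.sum_add_distrib]

theorem weight_zero (η : Fin M → WithTop ℝ) : weight η 0 = 0 := by
  simp [weight]

theorem weight_single (η : Fin M → WithTop ℝ) (i : Fin M) :
    weight η (Finsupp.single i 1) = η i := by
  rw [weight, Finset.sum_eq_single i]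
  · simp
  · intro j _ hj
    simp [hj.symm]
  · intro h
    exact absurd (Finset.mem_univ i) h

theorem nsmul_eq_top {n : ℕ} {a : WithTop ℝ} (hn : n ≠ 0) (ha : a = ⊤) : n • a = ⊤ := by
  obtain ⟨m, rfl⟩ := Nat.exists_eq_succ_of_ne_zero hn
  rw [succ_nsmul, ha, WithTop.add_top]

theorem weight_eq_sum {β : Fin M →₀ ℕ} (hβ : ∀ i, β i ≠ 0 → η i ≠ ⊤) :
    weight η β = ((∑ i, (β i : ℝ) * (η i).untopD 0 : ℝ) : WithTop ℝ) := by
  rw [weight, WithTop.coe_sum]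
  refine Finset.sum_congr rfl fun i _ => ?_
  by_cases h : β i = 0
  · simp [h]
  · obtain ⟨e, he⟩ := WithTop.ne_top_iff_exists.mp (hβ i h)
    rw [← he, WithTop.untopD_coe, ← WithTop.coe_nsmul, nsmul_eq_mul]

theorem weight_eq_top {β : Fin M →₀ ℕ} {i : Fin M} (hβ : β i ≠ 0) (hi : η i = ⊤) :
    weight η β = ⊤ := by
  rw [weight, WithTop.sum_eq_top]
  exact ⟨i, Finset.mem_univ _, nsmul_eq_top hβ hi⟩

/-- Monomials of infinite weight impose no condition, and those outside the support satisfy it since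
`ord 0 = ⊤`. Bounds can thus be checked coefficientwise in real arithmetic. -/
theorem le_polyOrd_iff {p : ℝ} {f : MvPolynomial (Fin M) (S ω K)} :
    (p : WithTop ℝ) ≤ polyOrd η f ↔
      ∀ β (w : ℝ), weight η β = w → ((p - w : ℝ) : WithTop ℝ) ≤ ord (f.coeff β) := by
  have hiff : ∀ (o : WithTop ℝ) (w : ℝ), ((p - w : ℝ) : WithTop ℝ) ≤ o ↔
      (p : WithTop ℝ) ≤ o + w := by
    intro o w
    induction o with
    | top => simp
    | coe o => rw [← WithTop.coe_add, WithTop.coe_le_coe, WithTop.coe_le_coe, sub_le_iff_le_add]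
  rw [polyOrd, Finset.le_inf_iff]
  constructor
  · intro h β w hw
    by_cases hβ : β ∈ f.support
    · exact (hiff _ _).mpr (hw ▸ h β hβ)
    · rw [MvPolynomial.notMem_support_iff.mp hβ, ord_zero]
      exact le_top
  · intro h β _
    by_cases hw : weight η β = ⊤
    · rw [hw, WithTop.add_top]
      exact le_top
    · obtain ⟨w, hw⟩ := WithTop.ne_top_iff_exists.mp hw
      rw [← hw]
      exact (hiff _ _).mp (h β w hw.symm)

/-- The part of weighted order `p` of a polynomial, an additive version of the initial part. -/
noncomputable def levelPart (η : Fin M → WithTop ℝ) (p : ℝ) (f : MvPolynomial (Fin M) (S ω K)) :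
    MvPolynomial (Fin M) (S ω K) :=
  ∑ β ∈ f.support, MvPolynomial.monomial β
    (if weight η β = ⊤ then 0 else part (p - (weight η β).untopD 0) (f.coeff β))

theorem coeff_levelPart (p : ℝ) (f : MvPolynomial (Fin M) (S ω K)) (β : Fin M →₀ ℕ) :
    (levelPart η p f).coeff β =
      if weight η β = ⊤ then 0 else part (p - (weight η β).untopD 0) (f.coeff β) := by
  classical
  rw [levelPart, MvPolynomial.coeff_sum]
  simp only [MvPolynomial.coeff_monomial, Finset.sum_ite_eq']
  split_ifs with h1 h2 h2
  · rfl
  · rfl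
  · rfl
  · rw [MvPolynomial.notMem_support_iff.mp h1, map_zero]

theorem coeff_levelPart_of_top (p : ℝ) (f : MvPolynomial (Fin M) (S ω K)) {β : Fin M →₀ ℕ}
    (h : weight η β = ⊤) : (levelPart η p f).coeff β = 0 := by
  rw [coeff_levelPart, if_pos h]

theorem coeff_levelPart_of_eq (p : ℝ) (f : MvPolynomial (Fin M) (S ω K)) {β : Fin M →₀ ℕ} {w : ℝ}
    (h : weight η β = w) : (levelPart η p f).coeff β = part (p - w) (f.coeff β) := by
  rw [coeff_levelPart, h, if_neg WithTop.coe_ne_top, WithTop.untopD_coe]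

theorem levelPart_sub (p : ℝ) (f g : MvPolynomial (Fin M) (S ω K)) :
    levelPart η p (f - g) = levelPart η p f - levelPart η p g := by
  ext1 β
  rw [MvPolynomial.coeff_sub, coeff_levelPart, coeff_levelPart, coeff_levelPart,
    MvPolynomial.coeff_sub, map_sub]
  split_ifs
  · rw [sub_zero]
  · rfl

theorem le_polyOrd_sub {p : ℝ} {f g : MvPolynomial (Fin M) (S ω K)}
    (hf : (p : WithTop ℝ) ≤ polyOrd η f) (hg : (p : WithTop ℝ) ≤ polyOrd η g) :
    (p : WithTop ℝ) ≤ polyOrd η (f - g) := by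
  rw [le_polyOrd_iff] at *
  intro β w hw
  have h1 := le_ord_iff.mp (hf β w hw)
  have h2 := le_ord_iff.mp (hg β w hw)
  rw [MvPolynomial.coeff_sub]
  refine le_ord_iff.mpr fun α hα => ?_
  by_contra hlt
  refine hα ?_
  rw [AddSubgroupClass.coe_sub, HahnSeries.coeff_sub]
  rw [not_not.mp fun h => hlt (h1 α h), not_not.mp fun h => hlt (h2 α h), sub_zero]

theorem exists_weights_of_add {β γ : Fin M →₀ ℕ} {w : ℝ} (h : weight η (β + γ) = w) :
    ∃ u v : ℝ, weight η β = u ∧ weight η γ = v ∧ u + v = w := by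
  rw [weight_add] at h
  obtain ⟨u, v, hu, hv, huv⟩ := WithTop.add_eq_coe.mp h
  exact ⟨u, v, hu.symm, hv.symm, huv⟩

theorem le_polyOrd_mul {p q : ℝ} {f g : MvPolynomial (Fin M) (S ω K)}
    (hf : (p : WithTop ℝ) ≤ polyOrd η f) (hg : (q : WithTop ℝ) ≤ polyOrd η g) :
    ((p + q : ℝ) : WithTop ℝ) ≤ polyOrd η (f * g) := by
  classical
  rw [le_polyOrd_iff] at *
  intro δ w hw
  rw [MvPolynomial.coeff_mul]
  refine le_ord_sum fun x hx => ?_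
  rw [← Finset.HasAntidiagonal.mem_antidiagonal.mp hx] at hw
  obtain ⟨u, v, hu, hv, rfl⟩ := exists_weights_of_add hw
  rw [add_sub_add_comm]
  exact le_ord_mul (hf _ _ hu) (hg _ _ hv)

/-- The coefficientwise form of `part_mul`. A product monomial has infinite weight only if one
factor does, so discarding those monomials is compatible with multiplication. -/
theorem levelPart_mul {p q : ℝ} {f g : MvPolynomial (Fin M) (S ω K)}
    (hf : (p : WithTop ℝ) ≤ polyOrd η f) (hg : (q : WithTop ℝ) ≤ polyOrd η g) :
    levelPart η (p + q) (f * g) = levelPart η p f * levelPart η q g := by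
  classical
  rw [le_polyOrd_iff] at hf hg
  ext1 δ
  rw [MvPolynomial.coeff_mul]
  by_cases hw : weight η δ = ⊤
  · rw [coeff_levelPart_of_top _ _ hw]
    refine (Finset.sum_eq_zero fun x hx => ?_).symm
    rw [← Finset.HasAntidiagonal.mem_antidiagonal.mp hx, weight_add, WithTop.add_eq_top] at hw
    rcases hw with hw | hw
    · rw [coeff_levelPart_of_top _ _ hw, zero_mul]
    · rw [coeff_levelPart_of_top _ _ hw, mul_zero]
  · obtain ⟨w, hw⟩ := WithTop.ne_top_iff_exists.mp hw
    rw [coeff_levelPart_of_eq _ _ hw.symm, MvPolynomial.coeff_mul, map_sum]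
    refine Finset.sum_congr rfl fun x hx => ?_
    rw [← Finset.HasAntidiagonal.mem_antidiagonal.mp hx] at hw
    obtain ⟨u, v, hu, hv, rfl⟩ := exists_weights_of_add hw.symm
    rw [coeff_levelPart_of_eq _ _ hu, coeff_levelPart_of_eq _ _ hv, add_sub_add_comm]
    exact part_mul (hf _ _ hu) (hg _ _ hv)

/-- Coefficients above the minimal level have zero part there, so no filter is needed on the right.
-/
theorem initPart_eq_levelPart (hω : LinearIndependent ℚ ω) {p : ℝ}
    {f : MvPolynomial (Fin M) (S ω K)} (hf : polyOrd η f = p) :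
    initPart η f = levelPart η p f := by
  classical
  have hle := le_polyOrd_iff.mp hf.ge
  ext1 β
  rw [initPart, if_neg (by rw [hf]; exact WithTop.coe_ne_top), MvPolynomial.coeff_sum]
  simp only [MvPolynomial.coeff_monomial, Finset.sum_ite_eq', Finset.mem_filter]
  by_cases hw : weight η β = ⊤
  · rw [coeff_levelPart_of_top _ _ hw, if_neg]
    rintro ⟨-, h⟩
    rw [hw, WithTop.add_top, hf] at h
    exact WithTop.coe_ne_top h.symm
  · obtain ⟨w, hw⟩ := WithTop.ne_top_iff_exists.mp hw
    rw [coeff_levelPart_of_eq _ _ hw.symm, ← hw, hf]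
    have hadd : ord (f.coeff β) + w = p ↔ ord (f.coeff β) = ((p - w : ℝ) : WithTop ℝ) := by
      induction ord (f.coeff β) with
      | top =>
        rw [WithTop.top_add]
        exact iff_of_false (fun h => WithTop.coe_ne_top h.symm) fun h => WithTop.coe_ne_top h.symm
      | coe o => rw [← WithTop.coe_add, WithTop.coe_inj, WithTop.coe_inj, eq_sub_iff_add_eq]
    by_cases ho : ord (f.coeff β) = ((p - w : ℝ) : WithTop ℝ)
    · have hβ : β ∈ f.support := by
        rw [MvPolynomial.mem_support_iff]
        intro h0
        rw [h0, ord_zero] at ho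
        exact WithTop.coe_ne_top ho.symm
      rw [if_pos ⟨hβ, hadd.mpr ho⟩, part_eq_firstTerm hω ho]
    · rw [if_neg fun h => ho (hadd.mp h.2),
        part_eq_zero_of_lt (lt_of_le_of_ne (hle β w hw.symm) (Ne.symm ho))]

theorem polyOrd_eq_of_levelPart_ne_zero {p : ℝ} {f : MvPolynomial (Fin M) (S ω K)}
    (hf : (p : WithTop ℝ) ≤ polyOrd η f) (hne : levelPart η p f ≠ 0) : polyOrd η f = p := by
  refine le_antisymm ?_ hf
  obtain ⟨β, hβ⟩ := MvPolynomial.ne_zero_iff.mp hne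
  by_cases hw : weight η β = ⊤
  · exact absurd (coeff_levelPart_of_top _ _ hw) hβ
  obtain ⟨w, hw⟩ := WithTop.ne_top_iff_exists.mp hw
  rw [coeff_levelPart_of_eq _ _ hw.symm] at hβ
  have ho := ord_eq_of_part_ne_zero (le_polyOrd_iff.mp hf β w hw.symm) hβ
  have hmem : β ∈ f.support := by
    rw [MvPolynomial.mem_support_iff]
    intro h0
    rw [h0, map_zero] at hβ
    exact hβ rfl
  refine (Finset.inf_le hmem).trans ?_
  rw [ho, ← hw, ← WithTop.coe_add, sub_add_cancel]

/-- Evaluating the part of order `p` at the initial parts of `ψ` gives the part of order `p` of the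
value at `ψ`. -/
theorem eval_levelPart {φ ψ : Fin M → S ω K} (hfin : ∀ i (e : ℝ), η i = e →
      (e : WithTop ℝ) ≤ ord (ψ i) ∧ part e (ψ i) = φ i)
    (htop : ∀ i, η i = ⊤ → ψ i = 0) {p : ℝ} {f : MvPolynomial (Fin M) (S ω K)}
    (hf : (p : WithTop ℝ) ≤ polyOrd η f) :
    MvPolynomial.eval φ (levelPart η p f) = part p (MvPolynomial.eval ψ f) := by
  rw [levelPart, map_sum, MvPolynomial.eval_eq' ψ f, map_sum]
  refine Finset.sum_congr rfl fun β _ => ?_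
  rw [MvPolynomial.eval_monomial, Finsupp.prod_fintype _ _ fun i => pow_zero _]
  -- Monomials involving some `y_i` with `η i = ⊤` are dropped from the level part and vanish at
  -- `ψ`, because `ψ i = 0`.
  by_cases hβ : ∀ i, β i ≠ 0 → η i ≠ ⊤
  · have hw := weight_eq_sum hβ
    set w : ℝ := ∑ i, (β i : ℝ) * (η i).untopD 0
    have hterm : ∀ i, (((β i : ℝ) * (η i).untopD 0 : ℝ) : WithTop ℝ) ≤ ord (ψ i ^ β i) ∧
        part ((β i : ℝ) * (η i).untopD 0) (ψ i ^ β i) = φ i ^ β i := by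
      intro i
      by_cases h : β i = 0
      · rw [h, Nat.cast_zero, zero_mul, pow_zero, pow_zero]
        exact ⟨zero_le_ord_one, part_zero_one⟩
      · obtain ⟨e, he⟩ := WithTop.ne_top_iff_exists.mp (hβ i h)
        obtain ⟨h1, h2⟩ := hfin i e he.symm
        rw [← he, WithTop.untopD_coe, ← h2]
        exact part_pow h1 _
    have hprod := part_prod Finset.univ fun i _ => (hterm i).1
    have hmul := part_mul (le_polyOrd_iff.mp hf β w hw) hprod.1
    rw [sub_add_cancel, hprod.2, Finset.prod_congr rfl fun i _ => (hterm i).2] at hmul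
    rw [hmul, hw, if_neg WithTop.coe_ne_top, WithTop.untopD_coe]
  · push Not at hβ
    obtain ⟨i, hi, hi'⟩ := hβ
    rw [weight_eq_top hi hi', if_pos rfl, zero_mul, Finset.prod_eq_zero (Finset.mem_univ i)
      (by rw [htop i hi', zero_pow hi]), mul_zero, map_zero]

theorem levelPart_C (p : ℝ) (a : S ω K) :
    levelPart η p (MvPolynomial.C a) = MvPolynomial.C (part p a) := by
  classical
  ext1 β
  by_cases hβ : 0 = β
  · subst hβ
    have : weight η 0 = ((0 : ℝ) : WithTop ℝ) := weight_zero η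
    rw [coeff_levelPart_of_eq _ _ this, sub_zero, MvPolynomial.coeff_C, if_pos rfl,
      MvPolynomial.coeff_C, if_pos rfl]
  · rw [coeff_levelPart, MvPolynomial.coeff_C, if_neg hβ, MvPolynomial.coeff_C, if_neg hβ,
      map_zero, ite_self]

theorem le_polyOrd_C {p : ℝ} {a : S ω K} (h : (p : WithTop ℝ) ≤ ord a) :
    (p : WithTop ℝ) ≤ polyOrd η (MvPolynomial.C a) := by
  classical
  refine le_polyOrd_iff.mpr fun β w hw => ?_
  rw [MvPolynomial.coeff_C]
  split_ifs with hβ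
  · have h0 : weight η 0 = ((0 : ℝ) : WithTop ℝ) := weight_zero η
    rw [← hβ, h0, WithTop.coe_inj] at hw
    rwa [← hw, sub_zero]
  · rw [ord_zero]
    exact le_top

theorem le_polyOrd_X {p : ℝ} {i : Fin M} (h : (p : WithTop ℝ) ≤ η i) :
    (p : WithTop ℝ) ≤ polyOrd η (MvPolynomial.X i : MvPolynomial (Fin M) (S ω K)) := by
  classical
  refine le_polyOrd_iff.mpr fun β w hw => ?_
  rw [MvPolynomial.coeff_X]
  split_ifs with hβ
  · rw [← hβ, weight_single] at hw
    rw [hw, WithTop.coe_le_coe] at h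
    refine le_trans ?_ zero_le_ord_one
    rw [WithTop.coe_le_coe]
    linarith
  · rw [ord_zero]
    exact le_top

theorem levelPart_X_of_lt {p : ℝ} {i : Fin M} (h : (p : WithTop ℝ) < η i) :
    levelPart η p (MvPolynomial.X i : MvPolynomial (Fin M) (S ω K)) = 0 := by
  by_contra hne
  have h1 := polyOrd_eq_of_levelPart_ne_zero (le_polyOrd_X h.le) hne
  by_cases hi : η i = ⊤
  · have h2 : polyOrd η (MvPolynomial.X i : MvPolynomial (Fin M) (S ω K)) = ⊤ := by
      rw [eq_top_iff, polyOrd, Finset.le_inf_iff]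
      intro β hβ
      rw [MvPolynomial.mem_support_iff] at hβ
      have : β = Finsupp.single i 1 := by
        by_contra hβ'
        classical
        exact hβ (by rw [MvPolynomial.coeff_X, if_neg (Ne.symm hβ')])
      rw [this, weight_single, hi, WithTop.add_top]
    exact WithTop.coe_ne_top (h1.symm.trans h2)
  · obtain ⟨e, he⟩ := WithTop.ne_top_iff_exists.mp hi
    have h2 := le_polyOrd_X (ω := ω) (K := K) (η := η) he.le
    rw [h1, he] at h2
    exact absurd h2 (not_le.mpr h)

theorem levelPart_X_of_eq {p : ℝ} {i : Fin M} (h : η i = p) :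
    levelPart η p (MvPolynomial.X i : MvPolynomial (Fin M) (S ω K)) = MvPolynomial.X i := by
  classical
  ext1 β
  by_cases hβ : Finsupp.single i 1 = β
  · rw [coeff_levelPart_of_eq p _ (w := p) (by rw [← hβ, weight_single, h]),
      MvPolynomial.coeff_X, if_pos hβ, sub_self, part_zero_one]
  · rw [coeff_levelPart, MvPolynomial.coeff_X, if_neg hβ, map_zero, ite_self]

/-! ### The two implications -/

/-- The polynomials whose initial part does not vanish at `φ`. -/
def nonvanishingInit (hω : LinearIndependent ℚ ω) (η : Fin M → WithTop ℝ) (φ : Fin M → S ω K) :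
    Submonoid (MvPolynomial (Fin M) (S ω K)) where
  carrier := {f | ∃ p : ℝ, (p : WithTop ℝ) ≤ polyOrd η f ∧
    MvPolynomial.eval φ (levelPart η p f) ≠ 0}
  one_mem' := by
    have := isDomain_S (K := K) hω
    refine ⟨0, ?_, ?_⟩
    · rw [← MvPolynomial.C_1]
      exact le_polyOrd_C zero_le_ord_one
    · rw [← MvPolynomial.C_1, levelPart_C, part_zero_one, MvPolynomial.eval_C]
      exact one_ne_zero
  mul_mem' := by
    -- Level parts multiply and the series form a domain, so nonvanishing at `φ` is inherited by
    -- products.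
    rintro f g ⟨p, hp, hf⟩ ⟨q, hq, hg⟩
    have := isDomain_S (K := K) hω
    refine ⟨p + q, le_polyOrd_mul hp hq, ?_⟩
    rw [levelPart_mul hp hq, map_mul]
    exact mul_ne_zero hf hg

theorem eval_initPart_ne_zero (hω : LinearIndependent ℚ ω) {φ : Fin M → S ω K}
    {f : MvPolynomial (Fin M) (S ω K)} (hf : f ∈ nonvanishingInit hω η φ) :
    MvPolynomial.eval φ (initPart η f) ≠ 0 := by
  obtain ⟨p, hp, hne⟩ := hf
  rwa [initPart_eq_levelPart hω (polyOrd_eq_of_levelPart_ne_zero hp fun h => hne (by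
    rw [h, map_zero]))]

/-- For finite `η i`, the initial part of `y_i - a` is `-in a`, `y_i` or `y_i - in a` as `ord a` is
smaller than, larger than or equal to `η i`; these are nonzero at `φ` because `a ≠ 0`, because `φ i
≠ 0`, and because `in a ≠ φ i`. If `η i = ⊤`, only `ord a < η i` can occur, since `ord a = ⊤` gives
`a = 0` with first term `0 = φ i`. -/
theorem X_sub_C_mem_nonvanishingInit (hω : LinearIndependent ℚ ω) {φ : Fin M → S ω K}
    (hφ : φ ∈ torus ω K η) {i : Fin M} {a : S ω K}
    (h : ¬(ord a = η i ∧ firstTerm a = φ i)) :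
    MvPolynomial.X i - MvPolynomial.C a ∈ nonvanishingInit hω η φ := by
  rcases lt_or_ge (ord a) (η i) with hlt | hle
  · obtain ⟨p, hp⟩ := WithTop.ne_top_iff_exists.mp hlt.ne_top
    refine ⟨p, le_polyOrd_sub (le_polyOrd_X (hp.trans_lt hlt).le) (le_polyOrd_C hp.le), ?_⟩
    rw [levelPart_sub, levelPart_X_of_lt (hp.trans_lt hlt), levelPart_C, zero_sub, map_neg,
      MvPolynomial.eval_C, part_eq_firstTerm hω hp.symm, neg_ne_zero]
    refine firstTerm_ne_zero fun h0 => ?_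
    rw [h0, ord_zero] at hp
    exact WithTop.coe_ne_top hp
  · by_cases hi : η i = ⊤
    · rw [hi, top_le_iff] at hle
      refine absurd ⟨hle.trans hi.symm, ?_⟩ h
      rw [ord_eq_top_iff.mp hle, firstTerm_zero, hφ.2 i hi]
    · obtain ⟨e, he⟩ := WithTop.ne_top_iff_exists.mp hi
      have hle' := he.trans_le hle
      refine ⟨e, le_polyOrd_sub (le_polyOrd_X he.le) (le_polyOrd_C hle'), ?_⟩
      rw [levelPart_sub, levelPart_X_of_eq he.symm, levelPart_C, map_sub, MvPolynomial.eval_X,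
        MvPolynomial.eval_C, sub_ne_zero]
      rcases hle'.eq_or_lt with heq | hlt
      · rw [part_eq_firstTerm hω heq.symm]
        exact fun h' => h ⟨heq.symm.trans he, h'.symm⟩
      · rw [part_eq_zero_of_lt hlt]
        exact hφ.1 i hi

theorem exists_zero_of_mem_zeroes_initIdeal [IsAlgClosed K] [CharZero K]
    (hω : LinearIndependent ℚ ω) {I : Ideal (MvPolynomial (Fin M) (S ω K))}
    (hI : (zeroes I).Finite) {φ : Fin M → S ω K} (hφ : φ ∈ torus ω K η)
    (h : φ ∈ zeroes (initIdeal η I)) :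
    ∃ ψ ∈ zeroes I, ∀ i, ord (ψ i) = η i ∧ firstTerm (ψ i) = φ i := by
  by_contra! hcon
  -- The value 1 at points that are not zeroes of `I` makes the choice total; the product below runs
  -- over the zeroes only.
  have hcon' : ∀ ψ : Fin M → S ω K, ∃ f ∈ nonvanishingInit hω η φ,
      ψ ∈ zeroes I → MvPolynomial.eval ψ f = 0 := by
    intro ψ
    by_cases hψ : ψ ∈ zeroes I
    · obtain ⟨i, hi⟩ := hcon ψ hψ
      exact ⟨_, X_sub_C_mem_nonvanishingInit hω hφ (a := ψ i) fun h => hi h.1 h.2,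
        fun _ => by simp⟩
    · exact ⟨1, Submonoid.one_mem _, fun h => absurd h hψ⟩
  choose f hf hfz using hcon'
  obtain ⟨n, hn⟩ := exists_pow_mem_of_eval_eq_zero hω I (f := ∏ ψ ∈ hI.toFinset, f ψ)
    fun ψ hψ => by
      rw [map_prod]
      exact Finset.prod_eq_zero (hI.mem_toFinset.mpr hψ) (hfz ψ hψ)
  exact eval_initPart_ne_zero hω
    (Submonoid.pow_mem _ (Submonoid.prod_mem _ fun ψ _ => hf ψ) n)
    (h _ (Ideal.subset_span (Or.inl ⟨_, hn, rfl⟩)))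

theorem mem_zeroes_initIdeal (hω : LinearIndependent ℚ ω)
    {I : Ideal (MvPolynomial (Fin M) (S ω K))} {φ ψ : Fin M → S ω K} (hφ : φ ∈ torus ω K η)
    (hord : ∀ i, ord (φ i) = η i) (hψ : ψ ∈ zeroes I) (hin : ∀ i, firstTerm (ψ i) = φ i) :
    φ ∈ zeroes (initIdeal η I) := by
  have hordψ : ∀ i, ord (ψ i) = η i := fun i => by rw [← ord_firstTerm, hin, hord]
  -- Vanishing at `φ` need only be checked on generators of the initial ideal.
  suffices h : initIdeal η I ≤ RingHom.ker (MvPolynomial.eval φ) from fun f hf => h hf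
  refine Ideal.span_le.mpr ?_
  rintro _ (⟨f, hf, rfl⟩ | ⟨i, hi, rfl⟩)
  · rw [SetLike.mem_coe, RingHom.mem_ker]
    by_cases htop : polyOrd η f = ⊤
    · rw [initPart, if_pos htop, map_zero]
    · obtain ⟨p, hp⟩ := WithTop.ne_top_iff_exists.mp htop
      rw [initPart_eq_levelPart hω hp.symm, eval_levelPart (ψ := ψ) ?_ ?_ hp.le, hψ f hf, map_zero]
      · intro i e he
        have h1 := (hordψ i).trans he
        exact ⟨h1.ge, by rw [part_eq_firstTerm hω h1, hin]⟩
      · intro i hi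
        exact ord_eq_top_iff.mp ((hordψ i).trans hi)
  · rw [SetLike.mem_coe, RingHom.mem_ker, MvPolynomial.eval_X, hφ.2 i hi]

end InitialPart

end OmegaPuiseux

theorem mainTheorem4 {K : Type*} [Field K] [IsAlgClosed K] [CharZero K] {N M : ℕ}
    (ω : Fin N → ℝ) (hω : LinearIndependent ℚ ω)
    (I : Ideal (MvPolynomial (Fin M) (OmegaPuiseux.S ω K)))
    (hI : (OmegaPuiseux.zeroes I).Finite)
    (η : Fin M → WithTop ℝ)
    (φ : Fin M → OmegaPuiseux.S ω K) (hφ : φ ∈ OmegaPuiseux.torus ω K η) :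
    φ ∈ OmegaPuiseux.zeroes (OmegaPuiseux.initIdeal η I) ↔
      (∀ i, OmegaPuiseux.ord (φ i) = η i) ∧
        ∃ ψ ∈ OmegaPuiseux.zeroes I, ∀ i, OmegaPuiseux.firstTerm (ψ i) = φ i := by
  constructor
  · intro h
    obtain ⟨ψ, hψ, hi⟩ := OmegaPuiseux.exists_zero_of_mem_zeroes_initIdeal hω hI hφ h
    exact ⟨fun i => by rw [← (hi i).2, OmegaPuiseux.ord_firstTerm, (hi i).1],
      ψ, hψ, fun i => (hi i).2⟩
  · rintro ⟨hord, ψ, hψ, hin⟩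
    exact OmegaPuiseux.mem_zeroes_initIdeal hω hφ hord hψ hin
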